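/- Let $K$ be a connected simple graph with countable vertex set $V(K)$ and path metric $d$. For vertices let $\langle x,y\rangle_z=\frac12(d(x,z)+d(y,z)-d(x,y))$. A finite, infinite or biinfinite path $\alpha$ is geodesic if $d(\alpha(m),\alpha(n))=|m-n|$ for all $m,n$. Assume that $K$ is hyperbolic: there is $\delta>0$ such that for all finite geodesic paths $\alpha,\beta$ with the same starting point $z$ and end points $\alpha_+,\beta_+$, one has $d(\alpha(k),\beta(k))<\delta$ for every integer $0\le k\le\langle\alpha_+,\beta_+\rangle_z$. Assume that $K$ is fine: for every $n$ and every edge $e$, only finitely many circuits (closed paths without repeated vertices) of length at most $n$ contain $e$. Let $\partial K$ be the set of infinite geodesic paths in $K$ modulo finite Hausdorff distance, and let $\Delta K=V(K)\cup\partial K$. For $x\in\Delta K$ and a finite set $A\subset V(K)$, let $M(x,A)$ be the set of all $z\in\Delta K$ such that no geodesic path connecting $x$ to $z$ meets $A\setminus\{x\}$. Give $\Delta K$ the topology in which $U$ is open if and only if for every $x\in U$ there is a finite $A\subset V(K)$ with $M(x,A)\subset U$. An action of a discrete group $\Gamma$ by homeomorphisms on a compact Hausdorff space $\Omega$ is called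 amenable if for every finite $E\subset\Gamma$ and every $\varepsilon>0$ there is a continuous map $\mu\colon\Omega\to\mathrm{Prob}(\Gamma)$, $\omega\mapsto\mu_\omega$, with $\|s\cdot\mu_\omega-\mu_{s\omega}\|_1\le\varepsilon$ for all $s\in E$ and $\omega\in\Omega$. Here $\mathrm{Prob}(\Gamma)$ is the set of nonnegative functions on $\Gamma$ of total mass one, with the topology of pointwise convergence, and $(s\cdot\mu)(t)=\mu(s^{-1}t)$. Let $\Gamma$ be a discrete group acting on $K$ by graph automorphisms with finitely many orbits of vertices and of edges, and let $\Gamma$ act by homeomorphisms on a compact Hausdorff space $Y$. Suppose that for every vertex $x$ the restricted action on $Y$ of the stabilizer $\Gamma^x=\{s\in\Gamma: sx=x\}$ is amenable. Then $\Delta K$ is a compact Hausdorff space on which $\Gamma$ acts by homeomorphisms, and the diagonal action of $\Gamma$ on $\Delta K\times Y$ is amenable. -/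

import Mathlib

universe u v w

namespace FineHyp

section Graph

variable {V : Type u}

/-! Geodesic paths in a graph, for the path metric `G.dist`. -/

/-- `α 0, …, α n` is a finite geodesic path of length `n` (values beyond `n` are irrelevant). -/
def IsGeodesicSegment (G : SimpleGraph V) (n : ℕ) (α : ℕ → V) : Prop :=
  ∀ i ≤ n, ∀ j ≤ n, (G.dist (α i) (α j) : ℤ) = |(i : ℤ) - (j : ℤ)|

/-- `α 0, α 1, …` is an infinite geodesic path. -/
def IsGeodesicRay (G : SimpleGraph V) (α : ℕ → V) : Prop :=
  ∀ i j : ℕ, (G.dist (α i) (α j) : ℤ) = |(i : ℤ) - (j : ℤ)|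

/-- `…, α (-1), α 0, α 1, …` is a biinfinite geodesic path. -/
def IsGeodesicLine (G : SimpleGraph V) (α : ℤ → V) : Prop :=
  ∀ i j : ℤ, (G.dist (α i) (α j) : ℤ) = |i - j|

/-- The Gromov product of `x` and `y` with respect to the base point `z`. -/
noncomputable def gromovProduct (G : SimpleGraph V) (x y z : V) : ℝ :=
  ((G.dist x z : ℝ) + (G.dist y z : ℝ) - (G.dist x y : ℝ)) / 2

/-- Hyperbolicity: all geodesic triangles are `δ`-thin for some `δ > 0`. -/
def IsHyperbolic (G : SimpleGraph V) : Prop :=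
  ∃ δ : ℝ, 0 < δ ∧ ∀ (m n : ℕ) (α β : ℕ → V),
    IsGeodesicSegment G m α → IsGeodesicSegment G n β → α 0 = β 0 →
    ∀ k : ℕ, (k : ℝ) ≤ gromovProduct G (α m) (β n) (α 0) →
      (G.dist (α k) (β k) : ℝ) < δ

/-- The (based, oriented) circuits of length at most `n` containing the edge `e`.
Closed paths of length at most two are not cycles for Mathlib; for a given edge there are only
finitely many of these, so finiteness of `circuits G e n` is not affected. -/
def circuits (G : SimpleGraph V) (e : Sym2 V) (n : ℕ) : Set (Σ x : V, G.Walk x x) :=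
  {c | c.2.IsCycle ∧ c.2.length ≤ n ∧ e ∈ c.2.edges}

/-- Fineness: every edge lies in only finitely many circuits of any given length. -/
def IsFine (G : SimpleGraph V) : Prop :=
  ∀ (n : ℕ), ∀ e ∈ G.edgeSet, (circuits G e n).Finite

/-- The type of infinite geodesic paths. -/
def Ray (G : SimpleGraph V) : Type u := {α : ℕ → V // IsGeodesicRay G α}

/-- Two infinite geodesic paths are equivalent if their Hausdorff distance is finite. -/
def rayEquiv (G : SimpleGraph V) (α β : Ray G) : Prop :=
  ∃ C : ℕ, (∀ m, ∃ n, G.edist (α.1 m) (β.1 n) ≤ C) ∧ (∀ n, ∃ m, G.edist (α.1 m) (β.1 n) ≤ C)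

instance raySetoid (G : SimpleGraph V) : Setoid (Ray G) where
  r := rayEquiv G
  iseqv :=
    { refl := fun α => ⟨0, fun m => ⟨m, by simp⟩, fun m => ⟨m, by simp⟩⟩
      symm := by
        rintro α β ⟨C, h1, h2⟩
        refine ⟨C, fun m => ?_, fun n => ?_⟩
        · obtain ⟨k, hk⟩ := h2 m
          exact ⟨k, by rwa [SimpleGraph.edist_comm]⟩
        · obtain ⟨k, hk⟩ := h1 n
          exact ⟨k, by rwa [SimpleGraph.edist_comm]⟩
      trans := by
        rintro α β γ ⟨C, h1, h2⟩ ⟨D, h3, h4⟩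
        refine ⟨C + D, fun m => ?_, fun n => ?_⟩
        · obtain ⟨k, hk⟩ := h1 m
          obtain ⟨l, hl⟩ := h3 k
          refine ⟨l, (SimpleGraph.edist_triangle (v := β.1 k)).trans ?_⟩
          push_cast
          exact add_le_add hk hl
        · obtain ⟨k, hk⟩ := h4 n
          obtain ⟨l, hl⟩ := h2 k
          refine ⟨l, (SimpleGraph.edist_triangle (v := β.1 k)).trans ?_⟩
          push_cast
          exact add_le_add hl hk }

/-- The Gromov boundary `∂K`. -/
def Boundary (G : SimpleGraph V) : Type u := Quotient (raySetoid G)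

/-- The boundary point `α₊` represented by an infinite geodesic path `α`. -/
def Boundary.mk {G : SimpleGraph V} (α : ℕ → V) (h : IsGeodesicRay G α) : Boundary G :=
  Quotient.mk (raySetoid G) ⟨α, h⟩

/-- The set `ΔK = V(K) ∪ ∂K`. -/
inductive Delta (G : SimpleGraph V) : Type u
  | vertex (x : V) : Delta G
  | bdry (ξ : Boundary G) : Delta G

theorem IsGeodesicLine.forward {G : SimpleGraph V} {α : ℤ → V} (h : IsGeodesicLine G α) :
    IsGeodesicRay G (fun n : ℕ => α (n : ℤ)) :=
  fun i j => h i j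

theorem IsGeodesicLine.backward {G : SimpleGraph V} {α : ℤ → V} (h : IsGeodesicLine G α) :
    IsGeodesicRay G (fun n : ℕ => α (-(n : ℤ))) := by
  intro i j
  rw [h, ← abs_neg]
  congr 1
  ring

/-- The family of vertex sets of the geodesic paths connecting `x` to `y`, for `x, y ∈ ΔK`. -/
def geodesicSets (G : SimpleGraph V) : Delta G → Delta G → Set (Set V)
  | .vertex x, .vertex y =>
      {S | ∃ (n : ℕ) (α : ℕ → V), IsGeodesicSegment G n α ∧ α 0 = x ∧ α n = y ∧
        S = α '' Set.Iic n}
  | .vertex x, .bdry ξ =>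
      {S | ∃ (α : ℕ → V) (h : IsGeodesicRay G α), α 0 = x ∧ Boundary.mk α h = ξ ∧
        S = Set.range α}
  | .bdry ξ, .vertex x =>
      {S | ∃ (α : ℕ → V) (h : IsGeodesicRay G α), α 0 = x ∧ Boundary.mk α h = ξ ∧
        S = Set.range α}
  | .bdry ξ, .bdry η =>
      {S | ∃ (α : ℤ → V) (h : IsGeodesicLine G α),
        Boundary.mk _ h.backward = ξ ∧ Boundary.mk _ h.forward = η ∧ S = Set.range α}

/-- `M(x, A)`: the points `z` such that no geodesic path from `x` to `z` meets `A ∖ {x}`. -/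
def basicNhd (G : SimpleGraph V) (x : Delta G) (A : Set V) : Set (Delta G) :=
  {z | ∀ S ∈ geodesicSets G x z, ∀ a ∈ A, Delta.vertex a ≠ x → a ∉ S}

theorem basicNhd_anti (G : SimpleGraph V) (x : Delta G) {A B : Set V} (h : A ⊆ B) :
    basicNhd G x B ⊆ basicNhd G x A :=
  fun _ hz S hS a ha hax => hz S hS a (h ha) hax

/-- The topology of `ΔK`: a set is open if and only if with every point `x` it contains `M(x, A)`
for some finite set `A` of vertices. -/
instance Delta.topology (G : SimpleGraph V) : TopologicalSpace (Delta G) where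
  IsOpen U := ∀ x ∈ U, ∃ A : Set V, A.Finite ∧ basicNhd G x A ⊆ U
  isOpen_univ := fun _ _ => ⟨∅, Set.finite_empty, Set.subset_univ _⟩
  isOpen_inter := by
    rintro U W hU hW x ⟨hxU, hxW⟩
    obtain ⟨A, hA, hAU⟩ := hU x hxU
    obtain ⟨B, hB, hBW⟩ := hW x hxW
    exact ⟨A ∪ B, hA.union hB, Set.subset_inter
      ((basicNhd_anti G x Set.subset_union_left).trans hAU)
      ((basicNhd_anti G x Set.subset_union_right).trans hBW)⟩
  isOpen_sUnion := by
    rintro s hs x ⟨U, hUs, hxU⟩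
    obtain ⟨A, hA, hAU⟩ := hs U hUs x hxU
    exact ⟨A, hA, hAU.trans (Set.subset_sUnion_of_mem hUs)⟩

end Graph

section GraphAction

variable {V : Type u} (Γ : Type v) [Group Γ] [MulAction Γ V]

/-- `Γ` acts on the graph `G` (by graph automorphisms). -/
class ActsOnGraph (G : SimpleGraph V) : Prop where
  adj_smul : ∀ (g : Γ) {x y : V}, G.Adj x y → G.Adj (g • x) (g • y)

/-- The quotient graph is finite: there are finitely many orbits of vertices and of edges. -/
structure HasFiniteQuotient (G : SimpleGraph V) : Prop where
  vertices : Finite (MulAction.orbitRel.Quotient Γ V)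
  edges : ∃ F : Set (Sym2 V), F.Finite ∧
    ∀ e ∈ G.edgeSet, ∃ f ∈ F, ∃ g : Γ, e = f.map (fun x => g • x)

variable {Γ} {G : SimpleGraph V} [ActsOnGraph Γ G]

theorem edist_smul_le (g : Γ) (x y : V) : G.edist (g • x) (g • y) ≤ G.edist x y := by
  by_cases h : G.edist x y = ⊤
  · rw [h]
    exact le_top
  · obtain ⟨p, hp⟩ := SimpleGraph.exists_walk_of_edist_ne_top h
    let f : G →g G := ⟨fun z => g • z, fun hz => ActsOnGraph.adj_smul g hz⟩
    rw [← hp, ← SimpleGraph.Walk.length_map f p]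
    exact SimpleGraph.edist_le (p.map f)

theorem edist_smul (g : Γ) (x y : V) : G.edist (g • x) (g • y) = G.edist x y := by
  refine le_antisymm (edist_smul_le g x y) ?_
  have h := edist_smul_le (G := G) g⁻¹ (g • x) (g • y)
  rwa [inv_smul_smul, inv_smul_smul] at h

theorem dist_smul (g : Γ) (x y : V) : G.dist (g • x) (g • y) = G.dist x y := by
  unfold SimpleGraph.dist
  rw [edist_smul]

/-- The translate of an infinite geodesic path. -/
def Ray.smul (g : Γ) (α : Ray G) : Ray G :=
  ⟨fun n => g • α.1 n, fun i j => by rw [dist_smul]; exact α.2 i j⟩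

/-- The action on the boundary. -/
def Boundary.smul (g : Γ) (ξ : Boundary G) : Boundary G :=
  Quotient.map (sa := raySetoid G) (sb := raySetoid G) (Ray.smul g)
    (by
      rintro α β ⟨C, h1, h2⟩
      refine ⟨C, fun m => ?_, fun n => ?_⟩
      · obtain ⟨k, hk⟩ := h1 m
        exact ⟨k, by simpa [Ray.smul, edist_smul] using hk⟩
      · obtain ⟨k, hk⟩ := h2 n
        exact ⟨k, by simpa [Ray.smul, edist_smul] using hk⟩) ξ

/-- The action of `Γ` on `ΔK` extending the action on the vertices. -/
instance Delta.mulAction : MulAction Γ (Delta G) where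
  smul g
    | .vertex x => .vertex (g • x)
    | .bdry ξ => .bdry (Boundary.smul g ξ)
  one_smul := by
    rintro (x | ξ)
    · exact congrArg Delta.vertex (one_smul Γ x)
    · refine congrArg Delta.bdry ?_
      induction ξ using Quotient.inductionOn with
      | h α => exact congrArg (Quotient.mk _) (Subtype.ext (funext fun n => one_smul Γ (α.1 n)))
  mul_smul := by
    rintro g h (x | ξ)
    · exact congrArg Delta.vertex (mul_smul g h x)
    · refine congrArg Delta.bdry ?_
      induction ξ using Quotient.inductionOn with
      | h α => exact congrArg (Quotient.mk _) (Subtype.ext (funext fun n => mul_smul g h (α.1 n)))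

end GraphAction

section Amenable

/-- Probability measures on the discrete group `Γ`, as nonnegative functions of total mass one,
with the topology of pointwise convergence. -/
abbrev Prob (Γ : Type v) : Type v := {μ : Γ → ℝ // (∀ s, 0 ≤ μ s) ∧ HasSum μ 1}

/-- The defining condition of amenability for an action of the discrete group `Γ` on the compact
(Hausdorff) space `Ω`: there are continuous maps `μ : Ω → Prob Γ` with
`‖s • μ ω - μ (s • ω)‖₁ ≤ ε` for all `s ∈ E` and `ω ∈ Ω`, where `(s • μ) t = μ (s⁻¹ t)`. -/
def IsAmenableAction (Γ : Type v) (Ω : Type w) [Group Γ] [TopologicalSpace Ω] [MulAction Γ Ω] :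
    Prop :=
  ∀ (E : Finset Γ) (ε : ℝ), 0 < ε → ∃ μ : Ω → Prob Γ, Continuous μ ∧
    ∀ s ∈ E, ∀ ω : Ω, ∑' t : Γ, |(μ ω).1 (s⁻¹ * t) - (μ (s • ω)).1 t| ≤ ε

end Amenable

end FineHyp

/-! Fineness replaces local finiteness. An edge lies in finitely many circuits of bounded length, so
the paths of length at most `n` between two vertices cover only finitely many vertices, uniformly in
the end points because there are finitely many orbits of edges (`exists_pathHull_bound`). An inner
vertex of a geodesic lies on such a path between any two vertices near the geodesic on either side
of it (`Seg.mem_pathHull`). By thinness, geodesics with a common end point are close up to a time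
shift (`UnifFineHyp.close`). Together these put the vertices of such geodesics in finite sets, so
pointwise limits along ultrafilters exist. This yields rays and lines to boundary points, and a
description of neighbourhoods in `Delta G` by geodesics from a base vertex (`exists_nhd_trace`),
hence the compact Hausdorff property.

For amenability, fix a base vertex `x` and let `reach G x z l k` be the set of points reached at
time `l` by geodesics to `z` from the `k`-ball at `x`. Balls may be infinite, yet for large `l` this
set has at most linearly many elements in `k`: the geodesics follow a single one up to one of `2k+1`
shifts. Moving `x` by `m` changes `k` by at most `m`, so averaging the uniform densities over `k` in
`[n, 2n)` gives almost equivariant densities on the vertices; the error is of order `m log n / n`.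

These densities are only Borel in `z`. For each finite measure they can be approximated in `L¹` by
continuous, finitely supported densities, whose defect from equivariance then has small integral.
The defect is convex in the density, so a Hahn-Banach separation and the Riesz theorem give one
continuous family whose defect is uniformly small (`exists_isDensity_defect_lt`). Finally each
vertex is replaced by an almost invariant density on `Γ`, induced from its stabilizer and depending
continuously on the point of `Y` (`isAmenableAction_prod`). -/

namespace FineHyp

/-! ### Fineness: uniform finiteness of path hulls -/

section Interval

variable {V : Type u} (G : SimpleGraph V)

/-- The vertices lying on a path (without repeated vertices) of length at most `n` from `x`
to `y`. -/
def pathHull (x y : V) (n : ℕ) : Set V :=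
  {v | ∃ p : G.Walk x y, p.IsPath ∧ p.length ≤ n ∧ v ∈ p.support}

/-- The vertices lying on a circuit of length at most `n` through the edge `e`. -/
def circuitHull (e : Sym2 V) (n : ℕ) : Set V :=
  {v | ∃ c ∈ circuits G e n, v ∈ c.2.support}

variable {G}

theorem pathHull_mono {x y : V} {m n : ℕ} (h : m ≤ n) : pathHull G x y m ⊆ pathHull G x y n := by
  rintro v ⟨p, hp, hl, hv⟩
  exact ⟨p, hp, hl.trans h, hv⟩

/-- Removing loops from each walk shrinks its support, so the two resulting paths still meet only at
`m` and concatenate to a path. -/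
theorem pathHull_of_walks {x m y : V} (p : G.Walk x m) (q : G.Walk m y)
    (h : ∀ u ∈ p.support, u ∈ q.support → u = m) : m ∈ pathHull G x y (p.length + q.length) := by
  classical
  refine ⟨p.bypass.append q.bypass, ?_, ?_, ?_⟩
  · rw [SimpleGraph.Walk.isPath_def, SimpleGraph.Walk.support_append]
    have hq := q.bypass_isPath
    rw [SimpleGraph.Walk.isPath_def, ← SimpleGraph.Walk.cons_tail_support, List.nodup_cons] at hq
    refine List.Nodup.append p.bypass_isPath.support_nodup hq.2 ?_
    intro u hu hu'
    have h1 := p.support_bypass_subset_support hu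
    have h2 := q.support_bypass_subset_support (List.mem_of_mem_tail hu')
    have := h u h1 h2
    subst this
    exact hq.1 hu'
  · rw [SimpleGraph.Walk.length_append]
    exact add_le_add p.length_bypass_le_length q.length_bypass_le_length
  · simp

theorem circuitHull_finite (hG : IsFine G) {e : Sym2 V} (he : e ∈ G.edgeSet) (n : ℕ) :
    (circuitHull G e n).Finite := by
  have : circuitHull G e n = ⋃ c ∈ circuits G e n, {v | v ∈ c.2.support} := by
    ext v; simp [circuitHull]
  rw [this]
  exact (hG n e he).biUnion fun c _ => c.2.support.finite_toSet

/-- A path between adjacent vertices either is the edge itself or is closed up by that edge to a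
circuit that is one longer. -/
theorem pathHull_adj_subset {x y : V} (h : G.Adj x y) (n : ℕ) :
    pathHull G x y n ⊆ {x, y} ∪ circuitHull G s(x, y) (n + 1) := by
  rintro v ⟨p, hp, hl, hv⟩
  by_cases he : s(x, y) ∈ p.edges
  · left
    rw [hp.eq_adj_toWalk_of_mem_edges he] at hv
    simpa using hv
  · right
    refine ⟨⟨y, SimpleGraph.Walk.cons h.symm p⟩, ⟨?_, ?_, ?_⟩, ?_⟩
    · rw [SimpleGraph.Walk.cons_isCycle_iff]
      exact ⟨hp, by rwa [Sym2.eq_swap]⟩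
    · simpa using hl
    · simp [Sym2.eq_swap]
    · simp [hv]

/-- A path from `x` either passes through `z` and splits there, or stays a path when the edge from
`z` to `x` is prepended. This is the induction step on the distance. -/
theorem pathHull_subset_of_adj {x y z : V} (h : G.Adj x z) (n : ℕ) :
    pathHull G x y n ⊆ pathHull G x z n ∪ pathHull G z y n ∪ pathHull G z y (n + 1) := by
  classical
  rintro v ⟨p, hp, hl, hv⟩
  by_cases hz : z ∈ p.support
  · left
    have hs := p.take_spec hz
    rw [← hs, SimpleGraph.Walk.mem_support_append_iff] at hv
    rcases hv with hv | hv
    · left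
      exact ⟨_, hp.takeUntil hz, (p.length_takeUntil_le_length hz).trans hl, hv⟩
    · right
      exact ⟨_, hp.dropUntil hz, (p.length_dropUntil_le_length hz).trans hl, hv⟩
  · right
    refine ⟨SimpleGraph.Walk.cons h.symm p, hp.cons hz, by simpa using hl, by simp [hv]⟩

section Uniform

variable {Γ : Type v} [Group Γ] [MulAction Γ V] [ActsOnGraph Γ G]

theorem circuitHull_map_subset (g : Γ) (e : Sym2 V) (n : ℕ) :
    circuitHull G (e.map fun x => g • x) n ⊆ (fun x => g • x) '' circuitHull G e n := by
  rintro v ⟨⟨x, c⟩, ⟨hc, hl, he⟩, hv⟩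
  let f : G →g G := ⟨fun z => g⁻¹ • z, fun hz => ActsOnGraph.adj_smul g⁻¹ hz⟩
  have hf : Function.Injective f := MulAction.injective g⁻¹
  refine ⟨g⁻¹ • v, ⟨⟨f x, c.map f⟩, ⟨?_, ?_, ?_⟩, ?_⟩, smul_inv_smul g v⟩
  · exact hc.map hf
  · simpa using hl
  · simp only [SimpleGraph.Walk.edges_map, List.mem_map]
    refine ⟨_, he, ?_⟩
    rw [Sym2.map_map]
    refine (Sym2.map_congr (g := id) fun x _ => inv_smul_smul g x).trans ?_
    rw [Sym2.map_id]
    rfl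
  · simp only [SimpleGraph.Walk.support_map, List.mem_map]
    exact ⟨v, hv, rfl⟩

theorem exists_circuitHull_bound (hG : IsFine G) (hquot : HasFiniteQuotient Γ G) (n : ℕ) :
    ∃ C : ℕ, ∀ e ∈ G.edgeSet, (circuitHull G e n).encard ≤ C := by
  obtain ⟨F, hF, hF'⟩ := hquot.edges
  -- The representatives in `F` need not be edges; only those that are have finite hulls.
  have hfin : ∀ f ∈ F ∩ G.edgeSet, ∃ C : ℕ, (circuitHull G f n).encard ≤ C := by
    rintro f ⟨-, hf⟩
    obtain ⟨C, hC⟩ := ENat.ne_top_iff_exists.1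
      (Set.encard_ne_top_iff.2 (circuitHull_finite hG hf n))
    exact ⟨C, hC.symm.le⟩
  choose! C hC using hfin
  have hFf : (F ∩ G.edgeSet).Finite := hF.inter_of_left _
  refine ⟨hFf.toFinset.sup C, fun e he => ?_⟩
  obtain ⟨f, hf, g, rfl⟩ := hF' e he
  have hfe : f ∈ G.edgeSet := by
    induction f using Sym2.ind with
    | h a b =>
      have : G.Adj (g • a) (g • b) := he
      have h2 := ActsOnGraph.adj_smul (G := G) g⁻¹ this
      rwa [inv_smul_smul, inv_smul_smul] at h2
  calc _ ≤ _ := Set.encard_le_encard (circuitHull_map_subset g f n)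
    _ ≤ _ := Set.encard_image_le _ _
    _ ≤ _ := hC f ⟨hf, hfe⟩
    _ ≤ _ := by
      exact_mod_cast Finset.le_sup (f := C) (hFf.mem_toFinset.2 ⟨hf, hfe⟩)

/-- The induction on the distance `k` treats all `n` at once, since its step replaces `n` by `n +
1`. -/
theorem exists_pathHull_bound_of_dist (hconn : G.Connected) (hG : IsFine G)
    (hquot : HasFiniteQuotient Γ G) (k : ℕ) :
    ∀ n : ℕ, ∃ C : ℕ, ∀ x y, G.dist x y = k → (pathHull G x y n).encard ≤ C := by
  have hadj : ∀ n, ∃ C : ℕ, ∀ x y, G.Adj x y → (pathHull G x y n).encard ≤ C := by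
    intro n
    obtain ⟨C, hC⟩ := exists_circuitHull_bound hG hquot (n + 1)
    refine ⟨2 + C, fun x y h => ?_⟩
    calc _ ≤ _ := Set.encard_le_encard (pathHull_adj_subset h n)
      _ ≤ _ := Set.encard_union_le _ _
      _ ≤ _ := by
        push_cast
        refine add_le_add ((Set.encard_insert_le _ _).trans ?_) (hC _ h)
        simp [one_add_one_eq_two]
  induction k with
  | zero =>
    refine fun n => ⟨1, fun x y h => ?_⟩
    obtain rfl := hconn.dist_eq_zero_iff.1 h
    refine (Set.encard_le_encard (t := {x}) ?_).trans (by simp)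
    rintro v ⟨p, hp, -, hv⟩
    obtain rfl := (SimpleGraph.Walk.isPath_iff_nil.1 hp).eq_nil
    simpa using hv
  | succ k ih =>
    intro n
    obtain ⟨C₁, h₁⟩ := hadj n
    obtain ⟨C₂, h₂⟩ := ih n
    obtain ⟨C₃, h₃⟩ := ih (n + 1)
    refine ⟨C₁ + C₂ + C₃, fun x y h => ?_⟩
    obtain ⟨p, hp⟩ := hconn.exists_walk_length_eq_dist x y
    rw [h] at hp
    cases p with
    | nil => simp at hp
    | @cons _ z _ hxz q =>
      simp only [SimpleGraph.Walk.length_cons, Nat.add_right_cancel_iff] at hp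
      have hzy : G.dist z y = k := by
        have h1 := G.dist_le q
        have h2 := hconn.dist_triangle (u := x) (v := z) (w := y)
        rw [SimpleGraph.dist_eq_one_iff_adj.2 hxz] at h2
        omega
      calc _ ≤ _ := Set.encard_le_encard (pathHull_subset_of_adj hxz n)
        _ ≤ _ := Set.encard_union_le _ _
        _ ≤ _ := add_le_add (Set.encard_union_le _ _) le_rfl
        _ ≤ _ := by
          push_cast
          exact add_le_add (add_le_add (h₁ _ _ hxz) (h₂ _ _ hzy)) (h₃ _ _ hzy)

/-- In a fine graph with finite quotient, path hulls are uniformly finite. -/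
theorem exists_pathHull_bound (hconn : G.Connected) (hG : IsFine G)
    (hquot : HasFiniteQuotient Γ G) (n : ℕ) :
    ∃ C : ℕ, ∀ x y, (pathHull G x y n).encard ≤ C := by
  choose C hC using fun k => exists_pathHull_bound_of_dist hconn hG hquot k n
  refine ⟨(Finset.range (n + 1)).sup C, fun x y => ?_⟩
  by_cases h : G.dist x y ≤ n
  · refine (hC _ x y rfl).trans ?_
    exact_mod_cast Finset.le_sup (f := C) (Finset.mem_range.2 (Nat.lt_succ_of_le h))
  · have : pathHull G x y n = ∅ := by
      refine Set.eq_empty_of_forall_notMem ?_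
      rintro v ⟨p, -, hl, -⟩
      exact h ((G.dist_le p).trans hl)
    simp [this]

end Uniform

end Interval


/-! ### Geodesic segments, rays and their equivalence -/

section Geodesic

variable {V : Type u} {G : SimpleGraph V}

/-- `α 0, …, α n` is a geodesic segment, with distances expressed in `ℕ`. -/
def Seg (G : SimpleGraph V) (n : ℕ) (α : ℕ → V) : Prop :=
  ∀ i j, i ≤ j → j ≤ n → G.dist (α i) (α j) + i = j

theorem seg_iff {n : ℕ} {α : ℕ → V} : Seg G n α ↔ IsGeodesicSegment G n α := by
  constructor
  · intro h i hi j hj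
    rcases le_total i j with hij | hij
    · have := h i j hij hj
      rw [abs_of_nonpos (by omega)]
      omega
    · have := h j i hij hi
      rw [SimpleGraph.dist_comm, abs_of_nonneg (by omega)]
      omega
  · intro h i j hij hj
    have := h i (hij.trans hj) j hj
    rw [abs_of_nonpos (by omega)] at this
    omega

theorem isGeodesicRay_iff {α : ℕ → V} :
    IsGeodesicRay G α ↔ ∀ i j, i ≤ j → G.dist (α i) (α j) + i = j := by
  constructor
  · intro h i j hij
    have := h i j
    rw [abs_of_nonpos (by omega)] at this
    omega
  · intro h i j
    rcases le_total i j with hij | hij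
    · have := h i j hij
      rw [abs_of_nonpos (by omega)]
      omega
    · have := h j i hij
      rw [SimpleGraph.dist_comm, abs_of_nonneg (by omega)]
      omega

theorem isGeodesicRay_iff_seg {α : ℕ → V} : IsGeodesicRay G α ↔ ∀ n, Seg G n α := by
  rw [isGeodesicRay_iff]
  exact ⟨fun h n i j hij _ => h i j hij, fun h i j hij => h j i j hij le_rfl⟩

theorem Seg.mono {m n : ℕ} {α : ℕ → V} (h : Seg G n α) (hm : m ≤ n) : Seg G m α :=
  fun i j hij hj => h i j hij (hj.trans hm)

theorem Seg.reverse {n : ℕ} {α : ℕ → V} (h : Seg G n α) : Seg G n (fun i => α (n - i)) := by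
  intro i j hij hj
  have := h (n - j) (n - i) (by omega) (by omega)
  rw [SimpleGraph.dist_comm]
  dsimp only
  omega

theorem Seg.shift {n k : ℕ} {α : ℕ → V} (h : Seg G (k + n) α) : Seg G n (fun i => α (k + i)) := by
  intro i j hij hj
  have := h (k + i) (k + j) (by omega) (by omega)
  dsimp only
  omega

/-- A connected graph with thin geodesic triangles and uniformly finite path hulls. -/
structure UnifFineHyp (G : SimpleGraph V) (δ : ℕ) : Prop where
  conn : G.Connected
  thin : ∀ (m n k : ℕ) (α β : ℕ → V), Seg G m α → Seg G n β → α 0 = β 0 →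
    2 * k + G.dist (α m) (β n) ≤ m + n → G.dist (α k) (β k) ≤ δ
  hull : ∀ n, ∃ C : ℕ, ∀ x y, (pathHull G x y n).encard ≤ C

/-- In `UnifFineHyp.thin` the bound on `k` by the Gromov product is written in `ℕ` without the
factor one half. The finite quotient serves only to make path hulls uniformly finite. -/
theorem IsHyperbolic.exists_unifFineHyp {Γ : Type v} [Group Γ] [MulAction Γ V] [ActsOnGraph Γ G]
    (hconn : G.Connected) (hfine : IsFine G) (hhyp : IsHyperbolic G)
    (hquot : HasFiniteQuotient Γ G) : ∃ δ, UnifFineHyp G δ := by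
  obtain ⟨δ, -, h⟩ := hhyp
  refine ⟨⌈δ⌉₊, hconn, ?_, exists_pathHull_bound hconn hfine hquot⟩
  intro m n k α β hα hβ h0 hk
  have h1 := h m n α β (seg_iff.1 hα) (seg_iff.1 hβ) h0 k ?_
  · exact_mod_cast (h1.le.trans (Nat.le_ceil δ))
  · have e1 := hα 0 m (Nat.zero_le _) le_rfl
    have e2 := hβ 0 n (Nat.zero_le _) le_rfl
    rw [SimpleGraph.dist_comm] at e1 e2
    have e1' : G.dist (α m) (α 0) = m := by omega
    have e2' : G.dist (β n) (α 0) = n := by rw [h0]; omega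
    rw [gromovProduct, e1', e2']
    have hk' : (2 * k + G.dist (α m) (β n) : ℝ) ≤ m + n := by exact_mod_cast hk
    linarith

theorem exists_seg (hconn : G.Connected) (x y : V) :
    ∃ α : ℕ → V, α 0 = x ∧ Seg G (G.dist x y) α ∧ ∀ k, G.dist x y ≤ k → α k = y := by
  obtain ⟨p, hp⟩ := hconn.exists_walk_length_eq_dist x y
  refine ⟨p.getVert, by simp, ?_, ?_⟩
  · have key : ∀ i j, i ≤ j → G.dist (p.getVert i) (p.getVert j) + i ≤ j := by
      intro i j hij
      induction j, hij using Nat.le_induction with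
      | base => simp
      | succ j hij ih =>
        have h1 : G.dist (p.getVert j) (p.getVert (j + 1)) ≤ 1 := by
          by_cases hj : j < p.length
          · exact (SimpleGraph.dist_eq_one_iff_adj.2 (p.adj_getVert_succ hj)).le
          · rw [p.getVert_of_length_le (by omega), p.getVert_of_length_le (by omega)]
            simp
        have h2 := hconn.dist_triangle (u := p.getVert i) (v := p.getVert j)
          (w := p.getVert (j + 1))
        omega
    intro i j hij hj
    have h1 := key 0 i (Nat.zero_le _)
    have h2 := key i j hij
    have h3 := key j p.length (by omega)
    simp only [SimpleGraph.Walk.getVert_zero, SimpleGraph.Walk.getVert_length] at h1 h3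
    have h4 := hconn.dist_triangle (u := x) (v := p.getVert i) (w := y)
    have h5 := hconn.dist_triangle (u := p.getVert i) (v := p.getVert j) (w := y)
    omega
  · intro k hk
    exact p.getVert_of_length_le (by omega)

theorem exists_short_walk (hconn : G.Connected) (x y : V) :
    ∃ p : G.Walk x y, p.length = G.dist x y ∧
      ∀ u ∈ p.support, G.dist x u + G.dist u y ≤ G.dist x y := by
  classical
  obtain ⟨p, hp⟩ := hconn.exists_walk_length_eq_dist x y
  refine ⟨p, hp, fun u hu => ?_⟩
  have h1 := G.dist_le (p.takeUntil u hu)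
  have h2 := G.dist_le (p.dropUntil u hu)
  have h3 := congrArg SimpleGraph.Walk.length (p.take_spec hu)
  rw [SimpleGraph.Walk.length_append] at h3
  omega

theorem Seg.exists_walk {n s t : ℕ} {α : ℕ → V} (h : Seg G n α) (hst : s ≤ t) (ht : t ≤ n) :
    ∃ p : G.Walk (α s) (α t), p.length + s = t ∧
      ∀ u ∈ p.support, ∃ r, s ≤ r ∧ r ≤ t ∧ u = α r := by
  induction t, hst using Nat.le_induction with
  | base => exact ⟨SimpleGraph.Walk.nil, by simp, fun u hu => ⟨s, le_rfl, le_rfl, by simpa using hu⟩⟩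
  | succ t hst ih =>
    obtain ⟨p, hp, hp'⟩ := ih (by omega)
    have hadj : G.Adj (α t) (α (t + 1)) := by
      rw [← SimpleGraph.dist_eq_one_iff_adj]
      have := h t (t + 1) (by omega) ht
      omega
    refine ⟨p.concat hadj, by rw [SimpleGraph.Walk.length_concat]; omega, fun u hu => ?_⟩
    rw [SimpleGraph.Walk.support_concat] at hu
    simp only [List.mem_append, List.mem_singleton] at hu
    rcases hu with hu | rfl
    · obtain ⟨r, h1, h2, h3⟩ := hp' u hu
      exact ⟨r, h1, h2.trans (Nat.le_succ t), h3⟩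
    · exact ⟨t + 1, by omega, le_rfl, rfl⟩

/-- An interior point of a geodesic lies in the path hull of two points close to it. -/
theorem Seg.mem_pathHull (hconn : G.Connected) {n s l t : ℕ} {α : ℕ → V} (h : Seg G n α)
    (ht : t ≤ n) {p q : V} {a b : ℕ} (hp : G.dist p (α s) ≤ a) (hq : G.dist q (α t) ≤ b)
    (hs : s + a < l) (hl : l + b < t) {L : ℕ} (hL : a + b + t ≤ L + s) :
    α l ∈ pathHull G p q L := by
  obtain ⟨p₁, hp₁, hp₁'⟩ := exists_short_walk hconn p (α s)
  obtain ⟨p₂, hp₂, hp₂'⟩ := h.exists_walk (s := s) (t := l) (by omega) (by omega)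
  obtain ⟨p₃, hp₃, hp₃'⟩ := h.exists_walk (s := l) (t := t) (by omega) (by omega)
  obtain ⟨p₄, hp₄, hp₄'⟩ := exists_short_walk hconn (α t) q
  rw [SimpleGraph.dist_comm] at hq
  -- The walk runs from `p` to `α s`, along `α` through `α l` to `α t`, then to `q`. The outer
  -- pieces stay within `a` of `α s` and `b` of `α t`, so the halves before and after `α l` share no
  -- other vertex.
  have := pathHull_of_walks (p₁.append p₂) (p₃.append p₄) ?_
  · refine pathHull_mono ?_ this
    simp only [SimpleGraph.Walk.length_append]
    omega
  · intro u hu hu'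
    rw [SimpleGraph.Walk.mem_support_append_iff] at hu hu'
    rcases hu with hu | hu <;> rcases hu' with hu' | hu'
    · exfalso
      obtain ⟨r, h1, h2, rfl⟩ := hp₃' u hu'
      have h3 := hp₁' _ hu
      have h4 := h s r (by omega) (by omega)
      rw [SimpleGraph.dist_comm] at h4
      omega
    · exfalso
      have h1 := hp₁' _ hu
      have h2 := hp₄' _ hu'
      have h3 := h s t (by omega) (by omega)
      have h4 := hconn.dist_triangle (u := α s) (v := u) (w := α t)
      rw [SimpleGraph.dist_comm (u := α s) (v := u), SimpleGraph.dist_comm (u := u) (v := α t)] at h4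
      omega
    · obtain ⟨r, h1, h2, rfl⟩ := hp₂' u hu
      obtain ⟨r', h1', h2', h3⟩ := hp₃' _ hu'
      have h4 := h r r' (by omega) (by omega)
      rw [h3, SimpleGraph.dist_self] at h4
      obtain rfl : r = l := by omega
      rfl
    · exfalso
      obtain ⟨r, h1, h2, rfl⟩ := hp₂' u hu
      have h3 := hp₄' _ hu'
      have h4 := h r t (by omega) (by omega)
      rw [SimpleGraph.dist_comm] at h4
      omega

/-- Variant of `Seg.mem_pathHull` in which the geodesic starts at the first point. -/
theorem Seg.mem_pathHull_left (hconn : G.Connected) {n l t : ℕ} {α : ℕ → V} (h : Seg G n α)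
    (ht : t ≤ n) {q : V} {b : ℕ} (hq : G.dist q (α t) ≤ b)
    (hl : l + b < t) {L : ℕ} (hL : b + t ≤ L) :
    α l ∈ pathHull G (α 0) q L ∪ {α 0} := by
  rcases Nat.eq_zero_or_pos l with rfl | hl'
  · right; rfl
  · left
    exact h.mem_pathHull hconn ht (s := 0) (a := 0) (by simp) hq (by omega) hl (by omega)

theorem UnifFineHyp.hull_finite {δ : ℕ} (H : UnifFineHyp G δ) (x y : V) (n : ℕ) :
    (pathHull G x y n).Finite := by
  obtain ⟨C, hC⟩ := H.hull n
  exact Set.finite_of_encard_le_coe (hC x y)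

/-- The admissible times of a geodesic from `x` to a point of `ΔK`. -/
def Valid (G : SimpleGraph V) (x : V) : Delta G → ℕ → Prop
  | .vertex y, k => k ≤ G.dist x y
  | .bdry _, _ => True

/-- `α` is a geodesic from `x` to a point of `ΔK`, continued as a constant path at a vertex. -/
def GeoTo (G : SimpleGraph V) (x : V) : Delta G → (ℕ → V) → Prop
  | .vertex y, α => α 0 = x ∧ Seg G (G.dist x y) α ∧ ∀ k, G.dist x y ≤ k → α k = y
  | .bdry ξ, α => α 0 = x ∧ ∃ h : IsGeodesicRay G α, Boundary.mk α h = ξ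

theorem Valid.mono {x : V} {z : Delta G} {k l : ℕ} (h : Valid G x z l) (hk : k ≤ l) :
    Valid G x z k := by
  cases z with
  | vertex y => exact hk.trans h
  | bdry ξ => trivial

theorem GeoTo.zero {x : V} {z : Delta G} {α : ℕ → V} (h : GeoTo G x z α) : α 0 = x := by
  cases z with
  | vertex y => exact h.1
  | bdry ξ => exact h.1

theorem GeoTo.seg {x : V} {z : Delta G} {α : ℕ → V} (h : GeoTo G x z α) {n : ℕ}
    (hn : Valid G x z n) : Seg G n α := by
  cases z with
  | vertex y => exact h.2.1.mono hn
  | bdry ξ => exact isGeodesicRay_iff_seg.1 h.2.1 n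

theorem GeoTo.dist_zero {x : V} {z : Delta G} {α : ℕ → V} (h : GeoTo G x z α) {n : ℕ}
    (hn : Valid G x z n) : G.dist x (α n) = n := by
  have := h.seg hn 0 n (Nat.zero_le _) le_rfl
  rw [h.zero] at this
  omega

theorem GeoTo.eq_vertex {x : V} {z : Delta G} {α : ℕ → V} (h : GeoTo G x z α) {n : ℕ}
    (hn : ¬ Valid G x z n) : z = .vertex (α n) := by
  cases z with
  | vertex y => rw [h.2.2 n (not_le.1 hn).le]
  | bdry ξ => exact absurd trivial hn

theorem GeoTo.range_mem {x : V} {z : Delta G} {α : ℕ → V} (h : GeoTo G x z α) :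
    Set.range α ∈ geodesicSets G (.vertex x) z := by
  cases z with
  | vertex y =>
    refine ⟨G.dist x y, α, seg_iff.1 h.2.1, h.1, h.2.2 _ le_rfl, ?_⟩
    refine Set.Subset.antisymm ?_ (Set.image_subset_range _ _)
    rintro _ ⟨k, rfl⟩
    rcases le_total k (G.dist x y) with hk | hk
    · exact ⟨k, hk, rfl⟩
    · exact ⟨G.dist x y, Set.mem_Iic.2 le_rfl, by rw [h.2.2 _ le_rfl, h.2.2 k hk]⟩
  | bdry ξ =>
    obtain ⟨h0, h1, h2⟩ := h
    exact ⟨α, h1, h0, h2, rfl⟩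

theorem geoTo_vertex_of_seg {n : ℕ} {α : ℕ → V} (h : Seg G n α) :
    GeoTo G (α 0) (.vertex (α n)) (fun k => α (min k n)) := by
  have hn : G.dist (α 0) (α n) = n := by
    have := h 0 n (Nat.zero_le _) le_rfl
    omega
  refine ⟨by simp, ?_, ?_⟩
  · rw [hn]
    intro i j hij hj
    dsimp only
    rw [min_eq_left hj, min_eq_left (hij.trans hj)]
    exact h i j hij hj
  · intro k hk
    rw [hn] at hk
    dsimp only
    rw [min_eq_right hk]

theorem mem_geodesicSets_vertex {x : V} {z : Delta G} {S : Set V} :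
    S ∈ geodesicSets G (.vertex x) z ↔ ∃ α, GeoTo G x z α ∧ S = Set.range α := by
  refine ⟨fun h => ?_, ?_⟩
  · cases z with
    | vertex y =>
      obtain ⟨n, α, hα, rfl, rfl, rfl⟩ := h
      refine ⟨_, geoTo_vertex_of_seg (seg_iff.2 hα), ?_⟩
      ext u
      constructor
      · rintro ⟨k, hk, rfl⟩
        exact ⟨k, by dsimp only; rw [min_eq_left hk]⟩
      · rintro ⟨k, rfl⟩
        exact ⟨min k n, Set.mem_Iic.2 (min_le_right _ _), rfl⟩
    | bdry ξ =>
      obtain ⟨α, h, h0, h1, rfl⟩ := h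
      exact ⟨α, ⟨h0, h, h1⟩, rfl⟩
  · rintro ⟨α, hα, rfl⟩
    exact hα.range_mem

theorem geodesicSets_symm_vertex {x : V} {ξ : Boundary G} :
    geodesicSets G (.bdry ξ) (.vertex x) = geodesicSets G (.vertex x) (.bdry ξ) := rfl

theorem mem_basicNhd_vertex {x : V} {z : Delta G} {A : Set V} :
    z ∈ basicNhd G (.vertex x) A ↔ ∀ α, GeoTo G x z α → ∀ k, α k ∈ A → α k = x := by
  constructor
  · intro h α hα k hk
    by_contra hne
    exact h _ hα.range_mem _ hk (fun h' => hne (Delta.vertex.inj h')) ⟨k, rfl⟩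
  · intro h S hS a ha hax haS
    obtain ⟨α, hα, rfl⟩ := mem_geodesicSets_vertex.1 hS
    obtain ⟨k, rfl⟩ := haS
    exact hax (congrArg _ (h α hα k ha))

/-! ### Equivalence of rays -/

theorem rayEquiv_of_forall_ge (hconn : G.Connected) {α β : Ray G} (C N : ℕ)
    (h : ∀ n, N ≤ n → G.dist (α.1 n) (β.1 n) ≤ C) : rayEquiv G α β := by
  have key : ∀ n, G.edist (α.1 n) (β.1 n) ≤ ((C + 2 * N : ℕ) : ℕ∞) := by
    intro n
    rw [← (hconn (α.1 n) (β.1 n)).coe_dist_eq_edist]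
    norm_cast
    rcases le_total N n with hn | hn
    · exact (h n hn).trans (by omega)
    · have h1 := isGeodesicRay_iff.1 α.2 n N hn
      have h2 := isGeodesicRay_iff.1 β.2 n N hn
      have h3 := h N le_rfl
      have h4 := hconn.dist_triangle (u := α.1 n) (v := α.1 N) (w := β.1 n)
      have h5 := hconn.dist_triangle (u := α.1 N) (v := β.1 N) (w := β.1 n)
      rw [SimpleGraph.dist_comm (u := β.1 N)] at h5
      omega
  exact ⟨C + 2 * N, fun m => ⟨m, key m⟩, fun m => ⟨m, key m⟩⟩

/-- If `β n` is within `C` of `α m`, comparing distances to the starting points bounds `|n - m|` by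
`C + G.dist (α 0) (β 0)`. Hence Hausdorff closeness gives closeness at equal times. -/
theorem rayEquiv.exists_dist_le (hconn : G.Connected) {α β : Ray G} (h : rayEquiv G α β) :
    ∃ C, ∀ n, G.dist (α.1 n) (β.1 n) ≤ C := by
  obtain ⟨C, h, -⟩ := h
  refine ⟨2 * C + G.dist (α.1 0) (β.1 0), fun m => ?_⟩
  obtain ⟨n, hn⟩ := h m
  rw [← (hconn (α.1 m) (β.1 n)).coe_dist_eq_edist] at hn
  norm_cast at hn
  have h1 := isGeodesicRay_iff.1 α.2 0 m (Nat.zero_le _)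
  have h2 := isGeodesicRay_iff.1 β.2 0 n (Nat.zero_le _)
  have h3 : G.dist (β.1 n) (β.1 m) ≤ C + G.dist (α.1 0) (β.1 0) := by
    have e1 := hconn.dist_triangle (u := α.1 0) (v := β.1 0) (w := α.1 m)
    have e2 := hconn.dist_triangle (u := β.1 0) (v := β.1 n) (w := α.1 m)
    have e3 := hconn.dist_triangle (u := β.1 0) (v := α.1 0) (w := β.1 n)
    have e4 := hconn.dist_triangle (u := α.1 0) (v := α.1 m) (w := β.1 n)
    rw [SimpleGraph.dist_comm (u := β.1 n) (v := α.1 m)] at e2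
    rw [SimpleGraph.dist_comm (u := β.1 0) (v := α.1 0)] at e3
    rcases le_total n m with hnm | hnm
    · have := isGeodesicRay_iff.1 β.2 n m hnm
      omega
    · have := isGeodesicRay_iff.1 β.2 m n hnm
      rw [SimpleGraph.dist_comm]
      omega
  have h4 := hconn.dist_triangle (u := α.1 m) (v := β.1 n) (w := β.1 m)
  omega

theorem Boundary.mk_eq_iff (hconn : G.Connected) {α β : ℕ → V} {hα : IsGeodesicRay G α}
    {hβ : IsGeodesicRay G β} :
    Boundary.mk α hα = Boundary.mk β hβ ↔ ∃ C, ∀ n, G.dist (α n) (β n) ≤ C := by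
  constructor
  · intro h
    exact rayEquiv.exists_dist_le hconn (α := ⟨α, hα⟩) (β := ⟨β, hβ⟩) (Quotient.exact h)
  · rintro ⟨C, h⟩
    exact Quotient.sound (rayEquiv_of_forall_ge hconn (α := ⟨α, hα⟩) (β := ⟨β, hβ⟩) C 0
      fun n _ => h n)

theorem Boundary.mk_eq_of_forall_ge (hconn : G.Connected) {α β : ℕ → V} {hα : IsGeodesicRay G α}
    {hβ : IsGeodesicRay G β} (C N : ℕ) (h : ∀ n, N ≤ n → G.dist (α n) (β n) ≤ C) :
    Boundary.mk α hα = Boundary.mk β hβ :=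
  Quotient.sound (rayEquiv_of_forall_ge hconn (α := ⟨α, hα⟩) (β := ⟨β, hβ⟩) C N h)

theorem IsGeodesicRay.shift {α : ℕ → V} (h : IsGeodesicRay G α) (k : ℕ) :
    IsGeodesicRay G (fun i => α (k + i)) :=
  isGeodesicRay_iff_seg.2 fun n => (isGeodesicRay_iff_seg.1 h (k + n)).shift

theorem Boundary.mk_shift (hconn : G.Connected) {α : ℕ → V} (h : IsGeodesicRay G α) (k : ℕ) :
    Boundary.mk (fun i => α (k + i)) (h.shift k) = Boundary.mk α h := by
  refine (Boundary.mk_eq_iff hconn).2 ⟨k, fun n => ?_⟩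
  have := isGeodesicRay_iff.1 h n (k + n) (by omega)
  rw [SimpleGraph.dist_comm]
  omega

theorem GeoTo.shift (hconn : G.Connected) {x : V} {z : Delta G} {α : ℕ → V} (h : GeoTo G x z α)
    {k : ℕ} (hk : Valid G x z k) : GeoTo G (α k) z (fun i => α (k + i)) := by
  cases z with
  | vertex y =>
    obtain ⟨h0, h1, h2⟩ := h
    have hk' : G.dist (α k) y + k = G.dist x y := by
      have := h1 k _ hk le_rfl
      rwa [h2 _ le_rfl] at this
    refine ⟨rfl, ?_, fun i hi => h2 _ (by omega)⟩
    refine Seg.shift (h1.mono ?_)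
    omega
  | bdry ξ =>
    obtain ⟨h0, h1, rfl⟩ := h
    exact ⟨rfl, h1.shift k, Boundary.mk_shift hconn h1 k⟩

theorem GeoTo.valid_shift {x : V} {z : Delta G} {α : ℕ → V} (h : GeoTo G x z α)
    {k i : ℕ} (hk : Valid G x z (k + i)) : Valid G (α k) z i := by
  cases z with
  | vertex y =>
    obtain ⟨h0, h1, h2⟩ := h
    have hk2 : k + i ≤ G.dist x y := hk
    have := h1 k _ (by omega) le_rfl
    rw [h2 _ le_rfl] at this
    show i ≤ G.dist (α k) y
    omega
  | bdry ξ => trivial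

theorem GeoTo.take {x : V} {z : Delta G} {α : ℕ → V} (h : GeoTo G x z α) {k : ℕ}
    (hk : Valid G x z k) : GeoTo G x (.vertex (α k)) (fun i => α (min i k)) := by
  have := geoTo_vertex_of_seg (h.seg hk)
  rwa [h.zero] at this

/-- Initial parts of geodesics, as walks. -/
theorem GeoTo.exists_walk {x : V} {z : Delta G} {α : ℕ → V} (h : GeoTo G x z α) (n : ℕ) :
    ∃ p : G.Walk x (α n), p.length ≤ n ∧ ∀ u ∈ p.support, u ∈ Set.range α := by
  have key : ∀ m, Valid G x z m → ∃ p : G.Walk x (α m), p.length ≤ m ∧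
      ∀ u ∈ p.support, u ∈ Set.range α := by
    intro m hm
    obtain ⟨p, hp, hp'⟩ := (h.seg hm).exists_walk (Nat.zero_le m) le_rfl
    obtain rfl := h.zero
    exact ⟨p, by omega, fun u hu => by obtain ⟨r, -, -, rfl⟩ := hp' u hu; exact ⟨r, rfl⟩⟩
  by_cases hn : Valid G x z n
  · exact key n hn
  · cases z with
    | vertex y =>
      have hn' : G.dist x y < n := not_le.1 hn
      rw [h.2.2 n hn'.le]
      obtain ⟨p, hp, hp'⟩ := key (G.dist x y) (le_refl _)
      have e := h.2.2 _ le_rfl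
      exact ⟨p.copy rfl e, by simp; omega, by simpa using hp'⟩
    | bdry ξ => exact absurd trivial hn

theorem exists_geoTo_vertex (hconn : G.Connected) (x y : V) :
    ∃ α, GeoTo G x (.vertex y) α := exists_seg hconn x y

end Geodesic


/-! ### Geodesics with a common end point -/

section Hyperbolic

variable {V : Type u} {G : SimpleGraph V} {δ : ℕ}

/-- Thinness is applied to the reversed geodesics, which both start at `w`. The assumption `G.dist x
y ≤ t` keeps the time counted from `w` below the Gromov product of `x` and `y` at `w`. -/
theorem UnifFineHyp.close_vertex (H : UnifFineHyp G δ) {x y w : V} {α β : ℕ → V}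
    (hα : GeoTo G x (.vertex w) α) (hβ : GeoTo G y (.vertex w) β) {s t : ℕ}
    (ht : G.dist x y ≤ t) (htv : t ≤ G.dist y w) (hs : s + G.dist y w = t + G.dist x w) :
    G.dist (β t) (α s) ≤ δ := by
  obtain ⟨hα0, hα1, hα2⟩ := hα
  obtain ⟨hβ0, hβ1, hβ2⟩ := hβ
  have h1 := H.conn.dist_triangle (u := x) (v := y) (w := w)
  have h2 := H.conn.dist_triangle (u := y) (v := x) (w := w)
  rw [SimpleGraph.dist_comm (u := y) (v := x)] at h2
  have := H.thin _ _ (G.dist y w - t) _ _ hβ1.reverse hα1.reverse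
    (by simp [hα2 _ le_rfl, hβ2 _ le_rfl])
    (by
      simp only [Nat.sub_self, hα0, hβ0]
      rw [SimpleGraph.dist_comm (u := y) (v := x)]
      omega)
  have e1 : G.dist y w - (G.dist y w - t) = t := by omega
  have e2 : G.dist x w - (G.dist y w - t) = s := by omega
  simpa only [e1, e2] using this

/-- Two geodesics with the same end point in `ΔK` are synchronously close, up to a shift. -/
theorem UnifFineHyp.close (H : UnifFineHyp G δ) {x y : V} {z : Delta G} {α β : ℕ → V}
    (hα : GeoTo G x z α) (hβ : GeoTo G y z β) (T : ℕ) :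
    ∃ c : ℤ, -(G.dist x y : ℤ) ≤ c ∧ c ≤ G.dist x y ∧ ∀ s t : ℕ, G.dist x y ≤ t → t ≤ T →
      Valid G y z t → (s : ℤ) = t + c → G.dist (β t) (α s) ≤ 2 * δ := by
  cases z with
  | vertex w =>
    have h1 := H.conn.dist_triangle (u := x) (v := y) (w := w)
    have h2 := H.conn.dist_triangle (u := y) (v := x) (w := w)
    rw [SimpleGraph.dist_comm (u := y) (v := x)] at h2
    refine ⟨(G.dist x w : ℤ) - G.dist y w, by omega, by omega, fun s t ht _ htv hs => ?_⟩
    exact (H.close_vertex hα hβ ht htv (by omega)).trans (by omega)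
  | bdry ξ =>
    obtain ⟨hα0, hα1, rfl⟩ := id hα
    obtain ⟨hβ0, hβ1, hαβ⟩ := id hβ
    obtain ⟨C, hC⟩ := (Boundary.mk_eq_iff H.conn).1 hαβ
    -- The points `α N` and `β N` are `C`-close, so up to time `T` the ray `β` is `δ`-close to the
    -- segment `γ` from `y` to `α N`, which is `δ`-close to `α` after a shift. The shift depends on
    -- `N`, hence on `T`.
    set N := T + C with hN
    obtain ⟨γ, hγ⟩ := exists_geoTo_vertex H.conn y (α N)
    have hαN := hα.take (k := N) trivial
    have hd : G.dist x (α N) = N := hα.dist_zero trivial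
    have h1 := H.conn.dist_triangle (u := x) (v := y) (w := α N)
    have h2 := H.conn.dist_triangle (u := y) (v := x) (w := α N)
    rw [SimpleGraph.dist_comm (u := y) (v := x)] at h2
    have h3 := H.conn.dist_triangle (u := y) (v := α N) (w := β N)
    have h4 : G.dist y (β N) = N := hβ.dist_zero trivial
    have h5 := hC N
    rw [SimpleGraph.dist_comm] at h5
    refine ⟨(N : ℤ) - G.dist y (α N), by omega, by omega, fun s t ht htT _ hs => ?_⟩
    have h6 := H.close_vertex hαN hγ (s := s) (t := t) ht (by omega) (by omega)
    have h7 := H.thin N (G.dist y (α N)) t β γ (isGeodesicRay_iff_seg.1 hβ1 N) hγ.2.1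
      (by rw [hβ0, hγ.1]) (by
        rw [hγ.2.2 _ le_rfl, SimpleGraph.dist_comm]
        omega)
    have h8 := H.conn.dist_triangle (u := β t) (v := γ t) (w := α s)
    have h9 : min s N = s := by omega
    rw [h9] at h6
    omega

theorem UnifFineHyp.close_same (H : UnifFineHyp G δ) {x : V} {z : Delta G} {α β : ℕ → V}
    (hα : GeoTo G x z α) (hβ : GeoTo G x z β) (t : ℕ) : G.dist (β t) (α t) ≤ 2 * δ := by
  by_cases ht : Valid G x z t
  · obtain ⟨c, h1, h2, h3⟩ := H.close hα hβ t
    simp only [SimpleGraph.dist_self, Nat.cast_zero, neg_zero] at h1 h2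
    exact h3 t t (by simp) le_rfl ht (by omega)
  · have h1 := hα.eq_vertex ht
    have h2 := hβ.eq_vertex ht
    rw [h1] at h2
    rw [Delta.vertex.inj h2]
    simp

/-- All rays from `x` to `ξ` pass within `2 * δ` of one point `γ (n + 2 * δ + 1)`, far enough beyond
time `n` to place every `n`-th vertex in a single path hull. -/
theorem UnifFineHyp.slice_finite (H : UnifFineHyp G δ) (x : V) (ξ : Boundary G) (n : ℕ) :
    {v | ∃ α, GeoTo G x (.bdry ξ) α ∧ α n = v}.Finite := by
  rcases Set.eq_empty_or_nonempty {v | ∃ α, GeoTo G x (.bdry ξ) α ∧ α n = v} with h | h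
  · rw [h]
    exact Set.finite_empty
  · obtain ⟨-, γ, hγ, -⟩ := h
    refine ((H.hull_finite x (γ (n + 2 * δ + 1)) (2 * δ + (n + 2 * δ + 1))).union
      (Set.finite_singleton x)).subset ?_
    rintro _ ⟨α, hα, rfl⟩
    have := (hα.seg (n := n + 2 * δ + 1) trivial).mem_pathHull_left H.conn le_rfl (l := n)
      (H.close_same hα hγ _) (by omega) le_rfl
    rwa [hα.zero] at this

theorem exists_eventually_eq {ι : Type*} (U : Ultrafilter ι) {X : Type*} {f : ι → X} {F : Set X}
    (hF : F.Finite) (h : ∀ᶠ i in U, f i ∈ F) : ∃ v ∈ F, ∀ᶠ i in U, f i = v := by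
  have := (Ultrafilter.eventually_exists_mem_iff (f := U) hF (P := fun v i => f i = v)).1
    (h.mono fun i hi => ⟨f i, hi, rfl⟩)
  exact this

/-- Pointwise limits of longer and longer geodesic segments along an ultrafilter. -/
theorem exists_limit_ray {ι : Type*} (U : Ultrafilter ι) {β : ι → ℕ → V}
    (hfin : ∀ k, ∃ F : Set V, F.Finite ∧ ∀ᶠ i in U, β i k ∈ F)
    (hseg : ∀ k, ∀ᶠ i in U, Seg G k (β i)) :
    ∃ α, IsGeodesicRay G α ∧ ∀ k, ∀ᶠ i in U, β i k = α k := by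
  have : ∀ k, ∃ v, ∀ᶠ i in U, β i k = v := by
    intro k
    obtain ⟨F, hF, h⟩ := hfin k
    obtain ⟨v, -, hv⟩ := exists_eventually_eq U hF h
    exact ⟨v, hv⟩
  choose α hα using this
  refine ⟨α, isGeodesicRay_iff.2 fun i j hij => ?_, hα⟩
  obtain ⟨m, h1, h2, h3⟩ := ((hα i).and ((hα j).and (hseg j))).exists
  rw [← h1, ← h2]
  exact h3 i j hij le_rfl

/-- Every vertex is joined to every boundary point by a geodesic. -/
theorem UnifFineHyp.exists_geoTo (H : UnifFineHyp G δ) (x : V) (z : Delta G) :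
    ∃ α, GeoTo G x z α := by
  cases z with
  | vertex w => exact exists_geoTo_vertex H.conn x w
  | bdry ξ =>
    induction ξ using Quotient.inductionOn with
    | h γ =>
    obtain ⟨γ, hγ⟩ := γ
    set d := G.dist x (γ 0) with hd
    -- The ray is a limit along a nonprincipal ultrafilter of geodesics from `x` to `γ n`. The
    -- `k`-th vertices eventually stay in one finite path hull, because these geodesics pass within
    -- `δ` of a fixed later point of `γ`.
    choose β hβ using fun n => exists_geoTo_vertex H.conn x (γ n)
    have hγn : ∀ n, GeoTo G (γ 0) (.vertex (γ n)) (fun k => γ (min k n)) := fun n =>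
      geoTo_vertex_of_seg (isGeodesicRay_iff_seg.1 hγ n)
    have hlen : ∀ n, G.dist (γ 0) (γ n) = n := fun n => by
      have := isGeodesicRay_iff.1 hγ 0 n (Nat.zero_le _)
      omega
    have hlen' : ∀ n, n ≤ G.dist x (γ n) + d ∧ G.dist x (γ n) ≤ n + d := fun n => by
      have h1 := H.conn.dist_triangle (u := x) (v := γ 0) (w := γ n)
      have h2 := H.conn.dist_triangle (u := γ 0) (v := x) (w := γ n)
      rw [SimpleGraph.dist_comm (u := γ 0) (v := x)] at h2
      have := hlen n
      omega
    have hclose : ∀ n s t, d ≤ t → t ≤ n → s + n = t + G.dist x (γ n) →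
        G.dist (γ t) (β n s) ≤ δ := fun n s t h1 h2 h3 => by
      have := H.close_vertex (hβ n) (hγn n) (s := s) (t := t) h1 (by rw [hlen]; exact h2)
        (by rw [hlen]; exact h3)
      rwa [min_eq_left h2] at this
    have hseg : ∀ k n, k + d ≤ n → Seg G k (β n) := fun k n hn =>
      (hβ n).seg (by have := hlen' n; show k ≤ G.dist x (γ n); omega)
    obtain ⟨α, hα, hlim⟩ : ∃ α, IsGeodesicRay G α ∧ ∀ k,
        ∀ᶠ i in (Filter.hyperfilter ℕ : Filter ℕ), β i k = α k := by
      refine exists_limit_ray (Filter.hyperfilter ℕ) ?_ ?_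
      · intro k
        refine ⟨_, (H.hull_finite x (γ (k + d + δ + 1)) (2 * δ + k + 2 * d + 1)).union
          (Set.finite_singleton x),
          Filter.mem_of_superset (Nat.hyperfilter_le_atTop
            (Filter.eventually_ge_atTop (k + d + δ + 1 + d))) fun n hn => ?_⟩
        have hn' : k + d + δ + 1 + d ≤ n := hn
        have h1 := hlen' n
        obtain ⟨s, hs⟩ : ∃ s, s + n = k + d + δ + 1 + G.dist x (γ n) :=
          ⟨k + d + δ + 1 + G.dist x (γ n) - n, by omega⟩
        have h2 := hclose n s _ (by omega) (by omega) hs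
        have h3 := ((hβ n).seg (n := s) (by show s ≤ G.dist x (γ n); omega)).mem_pathHull_left
          H.conn le_rfl (l := k) h2 (by omega) (L := 2 * δ + k + 2 * d + 1) (by omega)
        rwa [(hβ n).zero] at h3
      · intro k
        exact Filter.mem_of_superset (Nat.hyperfilter_le_atTop
          (Filter.eventually_ge_atTop (k + d))) fun n hn => hseg k n hn
    · refine ⟨α, ?_, hα, ?_⟩
      · obtain ⟨n, hn⟩ := (hlim 0).exists
        rw [← hn, (hβ n).zero]
      · refine Boundary.mk_eq_of_forall_ge H.conn (δ + d) d fun t ht => ?_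
        obtain ⟨n, hn, hn'⟩ := ((hlim t).and
          (Nat.hyperfilter_le_atTop (Filter.eventually_ge_atTop (t + d)))).exists
        have hn2 : t + d ≤ n := hn'
        have h1 := hlen' n
        obtain ⟨s, hs⟩ : ∃ s, s + n = t + G.dist x (γ n) := ⟨t + G.dist x (γ n) - n, by omega⟩
        have h2 := hclose n s t ht (by omega) hs
        rw [← hn]
        have h3 : G.dist (β n s) (β n t) ≤ d := by
          rcases le_total s t with hst | hst
          · have := hseg t n hn2 s t hst le_rfl
            omega
          · have := (hβ n).seg (n := s) (by show s ≤ G.dist x (γ n); omega) t s hst le_rfl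
            rw [SimpleGraph.dist_comm]
            omega
        have h4 := H.conn.dist_triangle (u := γ t) (v := β n s) (w := β n t)
        rw [SimpleGraph.dist_comm (u := β n t)]
        show G.dist (γ t) (β n t) ≤ _
        omega

/-- If a geodesic from `x` to `w` avoids `v`, then the first step of any geodesic from `v` to `w`
lies in a fixed path hull. -/
theorem UnifFineHyp.first_mem_pathHull (H : UnifFineHyp G δ) {x v : V} {w : Delta G}
    {α β : ℕ → V} (hα : GeoTo G x w α) (hv : v ∉ Set.range α) (hβ : GeoTo G v w β)
    (h1 : Valid G v w 1) {L : ℕ} (hL : 3 * G.dist x v + 6 * δ + 2 ≤ L) :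
    β 1 ∈ pathHull G x v L := by
  have hadj : G.Adj (β 1) v := by
    rw [← SimpleGraph.dist_eq_one_iff_adj, SimpleGraph.dist_comm]
    exact hβ.dist_zero h1
  suffices ∃ p : G.Walk x (β 1), p.length + 1 ≤ L ∧ v ∉ p.support by
    obtain ⟨p, hp, hvp⟩ := this
    have := pathHull_of_walks p hadj.toWalk (by
      intro u hu hu'
      simp only [SimpleGraph.Adj.support_toWalk, List.mem_cons, List.not_mem_nil, or_false] at hu'
      rcases hu' with rfl | rfl
      · rfl
      · exact absurd hu hvp)
    exact pathHull_mono (by simpa using hp) this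
  have hback : ∀ t, 1 ≤ t → Valid G v w t → ∃ p : G.Walk (β t) (β 1), p.length + 1 = t ∧
      v ∉ p.support := by
    intro t ht htv
    obtain ⟨p, hp, hp'⟩ := (hβ.seg htv).exists_walk ht le_rfl
    refine ⟨p.reverse, by simpa using hp, fun hmem => ?_⟩
    rw [SimpleGraph.Walk.support_reverse, List.mem_reverse] at hmem
    obtain ⟨r, hr1, hr2, hr⟩ := hp' v hmem
    have := hβ.dist_zero (htv.mono hr2)
    rw [← hr, SimpleGraph.dist_self] at this
    omega
  -- The walk follows `α`, crosses to `β t` and returns along `β` to `β 1`. The crossing has length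
  -- at most `2 * δ < t`, so it misses `v`. If `β` ends before time `t`, the walk goes through the
  -- common end point.
  set t := G.dist x v + 2 * δ + 1 with ht
  by_cases htv : Valid G v w t
  · obtain ⟨c, hc1, hc2, hc⟩ := H.close hα hβ t
    obtain ⟨s, hs⟩ : ∃ s : ℕ, (s : ℤ) = t + c := ⟨(t + c).toNat, by omega⟩
    have hd := hc s t (by omega) le_rfl htv hs
    obtain ⟨p₁, hp₁, hp₁'⟩ := hα.exists_walk s
    obtain ⟨p₂, hp₂, hp₂'⟩ := exists_short_walk H.conn (α s) (β t)
    obtain ⟨p₃, hp₃, hp₃'⟩ := hback t (by omega) htv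
    rw [SimpleGraph.dist_comm] at hd
    refine ⟨(p₁.append p₂).append p₃, ?_, ?_⟩
    · simp only [SimpleGraph.Walk.length_append]
      omega
    · simp only [SimpleGraph.Walk.mem_support_append_iff]
      rintro ((h | h) | h)
      · exact hv (hp₁' v h)
      · have := hp₂' v h
        have := hβ.dist_zero htv
        omega
      · exact hp₃' h
  · cases w with
    | bdry ξ => exact absurd trivial htv
    | vertex w =>
      have htv' : G.dist v w < t := not_le.1 htv
      have h1' : 1 ≤ G.dist v w := h1
      obtain ⟨p₁, hp₁, hp₁'⟩ := hα.exists_walk (G.dist x w)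
      obtain ⟨p₃, hp₃, hp₃'⟩ := hback (G.dist v w) h1' (le_refl _)
      have e : α (G.dist x w) = β (G.dist v w) := by rw [hα.2.2 _ le_rfl, hβ.2.2 _ le_rfl]
      have h2 := H.conn.dist_triangle (u := x) (v := v) (w := w)
      refine ⟨(p₁.copy rfl e).append p₃, ?_, ?_⟩
      · simp only [SimpleGraph.Walk.length_append, SimpleGraph.Walk.length_copy]
        omega
      · simp only [SimpleGraph.Walk.mem_support_append_iff, SimpleGraph.Walk.support_copy]
        rintro (h | h)
        · exact hv (hp₁' v h)
        · exact hp₃' h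

end Hyperbolic


/-! ### Biinfinite geodesics and neighbourhoods of boundary points -/

section Boundary

variable {V : Type u} {G : SimpleGraph V} {δ : ℕ}

theorem isGeodesicLine_iff {α : ℤ → V} :
    IsGeodesicLine G α ↔ ∀ i j, i ≤ j → (G.dist (α i) (α j) : ℤ) + i = j := by
  constructor
  · intro h i j hij
    have := h i j
    rw [abs_of_nonpos (by omega)] at this
    omega
  · intro h i j
    rcases le_total i j with hij | hij
    · have := h i j hij
      rw [abs_of_nonpos (by omega)]
      omega
    · have := h j i hij
      rw [SimpleGraph.dist_comm, abs_of_nonneg (by omega)]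
      omega

/-- Two distinct boundary points are joined by a biinfinite geodesic. -/
theorem UnifFineHyp.exists_line (H : UnifFineHyp G δ) {ξ ω : Boundary G} (hne : ξ ≠ ω) :
    ∃ (α : ℤ → V) (h : IsGeodesicLine G α),
      Boundary.mk _ h.backward = ξ ∧ Boundary.mk _ h.forward = ω := by
  induction ξ using Quotient.inductionOn with
  | h γ =>
  obtain ⟨γ, hγ⟩ := γ
  obtain ⟨γ', h0, hγ', rfl⟩ := H.exists_geoTo (γ 0) (.bdry ω)
  obtain ⟨t₀, ht₀⟩ : ∃ t₀, δ < G.dist (γ t₀) (γ' t₀) := by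
    by_contra! hcon
    exact hne ((Boundary.mk_eq_iff H.conn (hα := hγ) (hβ := hγ')).2 ⟨δ, hcon⟩)
  have hsγ := isGeodesicRay_iff_seg.1 hγ
  have hsγ' := isGeodesicRay_iff_seg.1 hγ'
  -- Since the rays are more than `δ` apart at time `t₀`, the Gromov products of `γ n` and `γ' n` at
  -- `γ 0` are less than `t₀`. So the segments `β n` between them follow `γ` backwards and `γ'`
  -- forwards, except for a bounded middle part.
  have hlow : ∀ n, 2 * n < 2 * t₀ + G.dist (γ n) (γ' n) := by
    intro n
    by_contra! hcon
    exact absurd (H.thin n n t₀ γ γ' (hsγ n) (hsγ' n) h0.symm (by omega)) (by omega)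
  have hγn : ∀ n, G.dist (γ 0) (γ n) = n := fun n => by
    have := hsγ n 0 n (Nat.zero_le _) le_rfl
    omega
  have hγ'n : ∀ n, G.dist (γ 0) (γ' n) = n := fun n => by
    have := hsγ' n 0 n (Nat.zero_le _) le_rfl
    rw [h0] at this
    omega
  have hup : ∀ n, G.dist (γ n) (γ' n) ≤ 2 * n := fun n => by
    have := H.conn.dist_triangle (u := γ n) (v := γ 0) (w := γ' n)
    rw [SimpleGraph.dist_comm (u := γ n) (v := γ 0), hγn, hγ'n] at this
    omega
  choose β hβ using fun n => exists_geoTo_vertex H.conn (γ n) (γ' n)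
  set l : ℕ → ℕ := fun n => G.dist (γ n) (γ' n) with hl
  have hlow' : ∀ n, 2 * n < 2 * t₀ + l n := hlow
  have hup' : ∀ n, l n ≤ 2 * n := hup
  have hβ0 : ∀ n, β n 0 = γ n := fun n => (hβ n).1
  have hβs : ∀ n, Seg G (l n) (β n) := fun n => (hβ n).2.1
  have hβl : ∀ n, β n (l n) = γ' n := fun n => (hβ n).2.2 _ le_rfl
  have hA : ∀ n i, t₀ ≤ i → i ≤ n → G.dist (γ i) (β n (n - i)) ≤ δ := by
    intro n i hi hin
    have := H.thin n (l n) (n - i) _ _ (hsγ n).reverse (hβs n) (by simp [hβ0]) (by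
      rw [hβl, Nat.sub_self, hγ'n]
      have := hlow' n
      omega)
    have e : n - (n - i) = i := by omega
    simpa only [e] using this
  have hB : ∀ n i, t₀ ≤ i → i ≤ n → G.dist (γ' i) (β n (l n - (n - i))) ≤ δ := by
    intro n i hi hin
    have := H.thin n (l n) (n - i) _ _ (hsγ' n).reverse (hβs n).reverse (by simp [hβl]) (by
      simp only [Nat.sub_self]
      rw [hβ0, h0, hγn]
      have := hlow' n
      omega)
    have e : n - (n - i) = i := by omega
    simpa only [e] using this
  have hbig : ∀ N : ℕ, ∀ᶠ n in (Filter.hyperfilter ℕ : Filter ℕ), N ≤ n := fun N =>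
    Nat.hyperfilter_le_atTop (Filter.eventually_ge_atTop N)
  -- The segments are reparametrized so that their `n`-th vertex gets index `0`. The index `i` is so
  -- large that the vertex in question lies, with margin `δ`, between points close to `γ i` and `γ'
  -- i`.
  have hlim : ∀ s : ℤ, ∃ v, ∀ᶠ n in (Filter.hyperfilter ℕ : Filter ℕ),
      β n (n + s).toNat = v := by
    intro s
    set i := s.natAbs + δ + 2 * t₀ + 1 with hi
    obtain ⟨v, -, hv⟩ := exists_eventually_eq (Filter.hyperfilter ℕ)
      (f := fun n : ℕ => β n (n + s).toNat) (H.hull_finite (γ i) (γ' i) (2 * δ + 2 * i)) (by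
        filter_upwards [hbig i] with n hn
        have h1 := hlow' n
        have h2 := hup' n
        exact (hβs n).mem_pathHull H.conn (s := n - i) (t := l n - (n - i)) (by omega)
          (hA n i (by omega) hn) (hB n i (by omega) hn) (by omega) (by omega) (by omega))
    exact ⟨v, hv⟩
  choose α hα using hlim
  have hline : IsGeodesicLine G α := by
    refine isGeodesicLine_iff.2 fun i j hij => ?_
    obtain ⟨n, h1, h2, h3⟩ := ((hα i).and ((hα j).and
      (hbig (i.natAbs + j.natAbs + 2 * t₀ + 1)))).exists
    have h4 := hlow' n
    have := hβs n (n + i).toNat (n + j).toNat (by omega) (by omega)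
    rw [h1, h2] at this
    omega
  refine ⟨α, hline, ?_, ?_⟩
  · refine Boundary.mk_eq_of_forall_ge H.conn δ t₀ (hβ := hγ) fun i hi => ?_
    obtain ⟨n, h1, h2⟩ := ((hα (-i)).and (hbig i)).exists
    have := hA n i hi h2
    have e : ((n : ℤ) + -i).toNat = n - i := by omega
    rw [← h1, e, SimpleGraph.dist_comm]
    exact this
  · refine Boundary.mk_eq_of_forall_ge H.conn (δ + 2 * t₀) t₀ fun i hi => ?_
    obtain ⟨n, h1, h2⟩ := ((hα i).and (hbig (i + 2 * t₀))).exists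
    have h3 := hB n i hi (by omega)
    have h4 := hlow' n
    have h5 := hup' n
    have h6 := hβs n (l n - (n - i)) (n + i) (by omega) (by omega)
    have e : ((n : ℤ) + i).toNat = n + i := by omega
    rw [← h1, e]
    have h7 := H.conn.dist_triangle (u := γ' i) (v := β n (l n - (n - i))) (w := β n (n + i))
    rw [SimpleGraph.dist_comm]
    omega

theorem IsGeodesicLine.geoTo_forward (hconn : G.Connected) {α : ℤ → V} (h : IsGeodesicLine G α)
    (k : ℤ) : GeoTo G (α k) (.bdry (Boundary.mk _ h.forward)) (fun n : ℕ => α (k + n)) := by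
  have h' := isGeodesicLine_iff.1 h
  have hr : IsGeodesicRay G (fun n : ℕ => α (k + n)) := isGeodesicRay_iff.2 fun i j hij => by
    have := h' (k + i) (k + j) (by omega)
    omega
  refine ⟨by simp, hr, (Boundary.mk_eq_iff hconn).2 ⟨k.natAbs, fun n => ?_⟩⟩
  have := h (k + n) n
  have e : (k + n - n).natAbs = k.natAbs := by congr 1; omega
  rw [← Int.natCast_natAbs, e] at this
  exact_mod_cast this.le

theorem IsGeodesicLine.geoTo_backward (hconn : G.Connected) {α : ℤ → V} (h : IsGeodesicLine G α)
    (k : ℤ) : GeoTo G (α k) (.bdry (Boundary.mk _ h.backward)) (fun n : ℕ => α (k - n)) := by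
  have h' := isGeodesicLine_iff.1 h
  have hr : IsGeodesicRay G (fun n : ℕ => α (k - n)) := isGeodesicRay_iff.2 fun i j hij => by
    have := h' (k - j) (k - i) (by omega)
    rw [SimpleGraph.dist_comm]
    omega
  refine ⟨by simp, hr, (Boundary.mk_eq_iff hconn).2 ⟨k.natAbs, fun n => ?_⟩⟩
  have := h (k - n) (-n)
  have e : (k - n - -n).natAbs = k.natAbs := by congr 1; omega
  rw [← Int.natCast_natAbs, e] at this
  exact_mod_cast this.le

/-- A geodesic from `x` to a vertex `w` follows a ray from `x` to `ξ` as long as some ray from `w`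
to `ξ` avoids a suitable path hull. -/
theorem UnifFineHyp.near_of_avoid (H : UnifFineHyp G δ) {x w : V} {ξ : Boundary G}
    {γ μ α : ℕ → V} {j : ℕ} (hγ : GeoTo G x (.bdry ξ) γ) (hμ : GeoTo G w (.bdry ξ) μ)
    (hα : GeoTo G x (.vertex w) α)
    (hav : ∀ k, μ k ∉ pathHull G (γ j) (γ (j + 4 * δ + 2)) (8 * δ + 2)) :
    j ≤ G.dist x w ∧ ∀ i ≤ j, G.dist (α i) (γ i) ≤ 2 * δ := by
  set d := G.dist x w with hd
  set T := j + 8 * δ + 2 + 3 * d with hT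
  obtain ⟨c, hc1, hc2, hc⟩ := H.close hγ hμ T
  obtain ⟨T', hT'⟩ : ∃ T' : ℕ, (T' : ℤ) = T + c := ⟨(T + c).toNat, by omega⟩
  have h1 := hc T' T (by omega) le_rfl trivial hT'
  obtain ⟨σ, hσ0, hσ1, hσ2⟩ := exists_geoTo_vertex H.conn x (μ T)
  have hσe := hσ2 _ le_rfl
  set l := G.dist x (μ T) with hl
  have h2 : G.dist x (γ T') = T' := hγ.dist_zero trivial
  have h3 : T' ≤ l + 2 * δ := by
    have := H.conn.dist_triangle (u := x) (v := μ T) (w := γ T')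
    omega
  have hσγ : ∀ i, i + 2 * δ ≤ T' → G.dist (σ i) (γ i) ≤ δ := by
    intro i hi
    refine H.thin l T' i σ γ hσ1 (hγ.seg trivial) (by rw [hσ0, hγ.zero]) ?_
    rw [hσe]
    omega
  have h4 : G.dist w (μ T) = T := hμ.dist_zero trivial
  -- The question is whether the Gromov product of `w` and `μ T` at `x` is at least `j`. If so, `α`
  -- follows `σ`, hence `γ`, up to time `j`. Otherwise `μ` runs within `2 * δ` of `γ j` and `γ (j +
  -- 4 * δ + 2)`; the gap leaves room for a vertex of `μ` in the forbidden path hull.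
  by_cases hg : 2 * j + T ≤ d + l
  · have h5 := H.conn.dist_triangle (u := x) (v := w) (w := μ T)
    refine ⟨by omega, fun i hi => ?_⟩
    have h6 := H.thin d l i α σ hα.2.1 hσ1 (by rw [hσ0, hα.zero]) (by
      rw [hσe, hα.2.2 _ le_rfl]
      omega)
    have h7 := hσγ i (by omega)
    have h8 := H.conn.dist_triangle (u := α i) (v := σ i) (w := γ i)
    omega
  · exfalso
    have hclose : ∀ i, j ≤ i → i ≤ l → i + 2 * δ ≤ T' → l ≤ T + i ∧
        G.dist (γ i) (μ (T + i - l)) ≤ 2 * δ := by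
      intro i hi hil hiT
      have h5 : l ≤ T + i := by
        have := H.conn.dist_triangle (u := x) (v := w) (w := μ T)
        omega
      have h6 := H.thin l T (l - i) _ _ hσ1.reverse (hμ.seg (n := T) trivial).reverse
        (by simp [hσe]) (by
          simp only [Nat.sub_self]
          rw [hσ0, hμ.zero]
          omega)
      have e1 : l - (l - i) = i := by omega
      have e2 : T - (l - i) = T + i - l := by omega
      simp only [e1, e2] at h6
      have h7 := hσγ i hiT
      have h8 := H.conn.dist_triangle (u := γ i) (v := σ i) (w := μ (T + i - l))
      rw [SimpleGraph.dist_comm] at h7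
      exact ⟨h5, by omega⟩
    obtain ⟨h5, h6⟩ := hclose j le_rfl (by omega) (by omega)
    obtain ⟨h7, h8⟩ := hclose (j + 4 * δ + 2) (by omega) (by omega) (by omega)
    exact hav (T + j - l + 2 * δ + 1) ((hμ.seg trivial).mem_pathHull H.conn
      (n := T + (j + 4 * δ + 2) - l) le_rfl h6 h8 (by omega) (by omega) (by omega))

/-- Geodesics from `x` to points near `ξ` follow the rays from `x` to `ξ` for a long time. -/
theorem UnifFineHyp.near (H : UnifFineHyp G δ) {x : V} {w : Delta G} {ξ : Boundary G}
    {γ α : ℕ → V} {j : ℕ} (hγ : GeoTo G x (.bdry ξ) γ) (hα : GeoTo G x w α)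
    (hw : w ∈ basicNhd G (.bdry ξ) (pathHull G (γ j) (γ (j + 4 * δ + 2)) (8 * δ + 2))) :
    Valid G x w j ∧ ∀ i ≤ j, G.dist (α i) (γ i) ≤ 4 * δ := by
  cases w with
  | vertex w =>
    obtain ⟨μ, hμ⟩ := H.exists_geoTo w (.bdry ξ)
    have := H.near_of_avoid hγ hμ hα (fun k hk => hw _ hμ.range_mem _ hk (by simp) ⟨k, rfl⟩)
    exact ⟨this.1, fun i hi => (this.2 i hi).trans (by omega)⟩
  | bdry ω =>
    refine ⟨trivial, fun i hi => ?_⟩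
    by_cases hξω : ξ = ω
    · subst hξω
      exact (H.close_same hγ hα i).trans (by omega)
    obtain ⟨μ, hμ, hb, hf⟩ := H.exists_line hξω
    have hav : ∀ k, μ k ∉ pathHull G (γ j) (γ (j + 4 * δ + 2)) (8 * δ + 2) := fun k hk =>
      hw (Set.range μ) ⟨μ, hμ, hb, hf, rfl⟩ _ hk (by simp) ⟨k, rfl⟩
    have hf0 := hμ.geoTo_forward H.conn 0
    rw [hf] at hf0
    -- The vertex case is applied to a point `μ T` far out on the line towards `ω`, whose backward
    -- half avoids the hull. The geodesic to `μ T` is then compared with `α`.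
    set T := j + 2 * δ + 2 * G.dist x (μ 0) with hT
    obtain ⟨c, hc1, hc2, hc⟩ := H.close hα hf0 T
    obtain ⟨T', hT'⟩ : ∃ T' : ℕ, (T' : ℤ) = T + c := ⟨(T + c).toNat, by omega⟩
    have h1 := hc T' T (by omega) le_rfl trivial hT'
    simp only [zero_add] at h1
    have hb0 := hμ.geoTo_backward H.conn T
    rw [hb] at hb0
    obtain ⟨β, hβ⟩ := exists_geoTo_vertex H.conn x (μ T)
    obtain ⟨h2, h3⟩ := H.near_of_avoid hγ hb0 hβ (fun k => hav _)
    have h4 := h3 i hi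
    have h5 : G.dist x (α T') = T' := hα.dist_zero trivial
    have h6 := H.conn.dist_triangle (u := x) (v := μ T) (w := α T')
    have h7 := H.thin T' _ i α β (hα.seg trivial) hβ.2.1 (by rw [hα.zero, hβ.zero]) (by
      rw [hβ.2.2 _ le_rfl, SimpleGraph.dist_comm]
      omega)
    have h8 := H.conn.dist_triangle (u := α i) (v := β i) (w := γ i)
    omega

/-- Points reached by a geodesic following a ray to `ξ` for a long time are close to `ξ`. -/
theorem UnifFineHyp.far (H : UnifFineHyp G δ) {x : V} {ξ : Boundary G} {γ : ℕ → V}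
    (hγ : GeoTo G x (.bdry ξ) γ) {A : Set V} (hA : A.Finite) :
    ∃ n, ∀ (w : Delta G) (α : ℕ → V), GeoTo G x w α → Valid G x w n → α n = γ n →
      w ∈ basicNhd G (.bdry ξ) A := by
  obtain ⟨R, hR⟩ := (hA.image (G.dist x)).bddAbove
  have hR' : ∀ a ∈ A, G.dist x a ≤ R := fun a ha => hR ⟨a, ha, rfl⟩
  set n := R + 4 * δ + 1 with hn
  refine ⟨n, fun w α hα hv hαn S hS a ha _ haS => ?_⟩
  -- A vertex `a` of `A` on the geodesic lies between points `y₁`, `y₂` near `γ T₁` and `α T₂`. Both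
  -- paths pass through `γ n`, so `y₁` and `y₂` are at most `T₁ + T₂ - 2n + 4δ` apart, while passing
  -- through `a` costs at least `T₁ + T₂ - 4δ - 2R`. This is impossible for `n > R + 4δ`.
  suffices ∃ y₁ y₂ T₁ T₂, n ≤ T₁ ∧ n ≤ T₂ ∧ Valid G x w T₂ ∧ G.dist y₁ (γ T₁) ≤ 2 * δ ∧
      G.dist y₂ (α T₂) ≤ 2 * δ ∧ G.dist y₁ a + G.dist a y₂ ≤ G.dist y₁ y₂ by
    obtain ⟨y₁, y₂, T₁, T₂, h1, h2, h3, h4, h5, h6⟩ := this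
    have e1 := hγ.dist_zero (n := T₁) trivial
    have e2 := hα.dist_zero h3
    have e3 := H.conn.dist_triangle (u := x) (v := y₁) (w := γ T₁)
    have e4 := H.conn.dist_triangle (u := x) (v := y₂) (w := α T₂)
    have e5 := H.conn.dist_triangle (u := x) (v := a) (w := y₁)
    have e6 := H.conn.dist_triangle (u := x) (v := a) (w := y₂)
    have e7 := hγ.seg (n := T₁) trivial n T₁ h1 le_rfl
    have e8 := hα.seg h3 n T₂ h2 le_rfl
    have e9 := H.conn.dist_triangle (u := y₁) (v := γ T₁) (w := γ n)
    have e10 := H.conn.dist_triangle (u := y₁) (v := γ n) (w := y₂)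
    have e11 := H.conn.dist_triangle (u := γ n) (v := α T₂) (w := y₂)
    have e12 := hR' a ha
    rw [SimpleGraph.dist_comm (u := a) (v := y₁)] at e5
    rw [SimpleGraph.dist_comm (u := γ T₁) (v := γ n)] at e9
    rw [SimpleGraph.dist_comm (u := α T₂) (v := y₂)] at e11
    rw [hαn] at e8
    omega
  cases w with
  | vertex w =>
    rw [geodesicSets_symm_vertex] at hS
    obtain ⟨μ, hμ, rfl⟩ := mem_geodesicSets_vertex.1 hS
    obtain ⟨k, rfl⟩ := haS
    set T := k + n + 2 * G.dist x w with hT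
    obtain ⟨c, hc1, hc2, hc⟩ := H.close hγ hμ T
    obtain ⟨T', hT'⟩ : ∃ T' : ℕ, (T' : ℤ) = T + c := ⟨(T + c).toNat, by omega⟩
    have h1 := hc T' T (by omega) le_rfl trivial hT'
    refine ⟨μ T, w, T', G.dist x w, by omega, hv, le_refl _, h1, ?_, ?_⟩
    · rw [hα.2.2 _ le_rfl]
      simp
    · have h2 := hμ.seg (n := T) trivial k T (by omega) le_rfl
      have h3 := hμ.dist_zero (n := k) trivial
      have h4 := hμ.dist_zero (n := T) trivial
      rw [SimpleGraph.dist_comm (u := μ T), SimpleGraph.dist_comm (v := w),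
        SimpleGraph.dist_comm (v := w)]
      omega
  | bdry ω =>
    obtain ⟨μ, hμ, hb, hf, rfl⟩ := hS
    obtain ⟨k, rfl⟩ := haS
    have hf0 := hμ.geoTo_forward H.conn 0
    rw [hf] at hf0
    have hb0 := hμ.geoTo_backward H.conn 0
    rw [hb] at hb0
    set T := k.natAbs + n + 2 * G.dist x (μ 0) with hT
    obtain ⟨c, hc1, hc2, hc⟩ := H.close hγ hb0 T
    obtain ⟨T₁, hT₁⟩ : ∃ T' : ℕ, (T' : ℤ) = T + c := ⟨(T + c).toNat, by omega⟩
    have h1 := hc T₁ T (by omega) le_rfl trivial hT₁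
    obtain ⟨c', hc1', hc2', hc'⟩ := H.close hα hf0 T
    obtain ⟨T₂, hT₂⟩ : ∃ T' : ℕ, (T' : ℤ) = T + c' := ⟨(T + c').toNat, by omega⟩
    have h2 := hc' T₂ T (by omega) le_rfl trivial hT₂
    refine ⟨_, _, T₁, T₂, by omega, by omega, trivial, h1, h2, ?_⟩
    have h' := isGeodesicLine_iff.1 hμ
    have e1 := h' (0 - T) k (by omega)
    have e2 := h' k (0 + T) (by omega)
    have e3 := h' (0 - T) (0 + T) (by omega)
    omega

end Boundary


/-! ### `Delta G` is compact and Hausdorff -/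

section DeltaTopology

variable {V : Type u} {G : SimpleGraph V} {δ : ℕ}

/-- Geodesics to points near `z` meet a finite set in the same way as some geodesic to `z`. -/
theorem UnifFineHyp.exists_nhd_trace (H : UnifFineHyp G δ) (x : V) (z : Delta G) {B : Set V}
    (hB : B.Finite) : ∃ A : Set V, A.Finite ∧ ∀ w ∈ basicNhd G z A, ∀ α, GeoTo G x w α →
      ∃ α', GeoTo G x z α' ∧ ∀ b ∈ B, b ∈ Set.range α ↔ b ∈ Set.range α' := by
  cases z with
  | vertex v =>
    -- Avoiding the path hull forces every geodesic from `x` to `w` through `v`, by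
    -- `first_mem_pathHull`; avoiding `B` ensures that it meets no further point of `B` after `v`.
    refine ⟨pathHull G x v (3 * G.dist x v + 6 * δ + 2) ∪ B, (H.hull_finite _ _ _).union hB,
      fun w hw α hα => ?_⟩
    rw [mem_basicNhd_vertex] at hw
    have hv : v ∈ Set.range α := by
      by_contra hv
      obtain ⟨β, hβ⟩ := H.exists_geoTo v w
      by_cases h1 : Valid G v w 1
      · have h2 := hw β hβ 1 (Or.inl (H.first_mem_pathHull hα hv hβ h1 le_rfl))
        have h3 := hβ.dist_zero h1
        rw [h2] at h3
        simp at h3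
      · cases w with
        | bdry ξ => exact h1 trivial
        | vertex w =>
          have h2 : G.dist v w < 1 := not_le.1 h1
          obtain rfl : v = w := H.conn.dist_eq_zero_iff.1 (by omega)
          exact hv ⟨_, hα.2.2 _ le_rfl⟩
    obtain ⟨k, hk, rfl⟩ : ∃ k, Valid G x w k ∧ α k = v := by
      obtain ⟨k, rfl⟩ := hv
      by_cases hk : Valid G x w k
      · exact ⟨k, hk, rfl⟩
      · have := hα.eq_vertex hk
        cases w with
        | bdry ξ => exact absurd trivial hk
        | vertex w =>
          exact ⟨G.dist x w, le_refl (G.dist x w), by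
            rw [hα.2.2 _ le_rfl]; exact Delta.vertex.inj this⟩
    refine ⟨_, hα.take hk, fun b hb => ⟨?_, ?_⟩⟩
    · rintro ⟨i, rfl⟩
      rcases le_total i k with hi | hi
      · exact ⟨i, by dsimp only; rw [min_eq_left hi]⟩
      · have e : k + (i - k) = i := by omega
        have := hw _ (hα.shift H.conn hk) (i - k) (by
          rw [e]
          exact Or.inr hb)
        rw [e] at this
        exact ⟨k, by dsimp only; rw [min_self, this]⟩
    · rintro ⟨i, rfl⟩
      exact ⟨_, rfl⟩
  | bdry ξ =>
    -- Counterexamples for the hulls along `γ` follow `γ` ever longer, so they converge pointwise to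
    -- a ray to `ξ`. One of them agrees with this limit throughout the ball containing `B`, a
    -- contradiction.
    by_contra! hcon
    obtain ⟨γ, hγ⟩ := H.exists_geoTo x (.bdry ξ)
    choose w hw α hα hne using fun n => hcon _ (H.hull_finite (γ n) (γ (n + 4 * δ + 2)) (8 * δ + 2))
    have hnear := fun n => H.near hγ (hα n) (hw n)
    have hbig : ∀ N : ℕ, ∀ᶠ n in (Filter.hyperfilter ℕ : Filter ℕ), N ≤ n := fun N =>
      Nat.hyperfilter_le_atTop (Filter.eventually_ge_atTop N)
    obtain ⟨α', hα', hlim⟩ : ∃ α', IsGeodesicRay G α' ∧ ∀ k,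
        ∀ᶠ n in (Filter.hyperfilter ℕ : Filter ℕ), α n k = α' k := by
      refine exists_limit_ray (Filter.hyperfilter ℕ) (fun k => ?_) (fun k => ?_)
      · set t := k + 4 * δ + 1
        refine ⟨_, (H.hull_finite x (γ t) (4 * δ + t)).union (Set.finite_singleton x), ?_⟩
        filter_upwards [hbig t] with n hn
        have h1 := ((hα n).seg ((hnear n).1.mono hn)).mem_pathHull_left H.conn le_rfl
          (l := k) (q := γ t) (b := 4 * δ)
          (by rw [SimpleGraph.dist_comm]; exact (hnear n).2 t hn) (by omega) le_rfl
        rwa [(hα n).zero] at h1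
      · filter_upwards [hbig k] with n hn
        exact (hα n).seg ((hnear n).1.mono hn)
    have hα'ξ : GeoTo G x (.bdry ξ) α' := by
      obtain ⟨hγ0, hγ1, rfl⟩ := id hγ
      refine ⟨?_, hα', (Boundary.mk_eq_iff H.conn).2 ⟨4 * δ, fun i => ?_⟩⟩
      · obtain ⟨n, hn⟩ := (hlim 0).exists
        rw [← hn, (hα n).zero]
      · obtain ⟨n, hn, hn'⟩ := ((hlim i).and (hbig i)).exists
        rw [← hn]
        exact (hnear n).2 i hn'
    obtain ⟨R, hR⟩ := (hB.image (G.dist x)).bddAbove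
    have hall : ∀ᶠ n in (Filter.hyperfilter ℕ : Filter ℕ), ∀ k ∈ Finset.range (R + 1),
        α n k = α' k := (Filter.eventually_all_finset _).2 fun k _ => hlim k
    obtain ⟨n, hn, hRn⟩ := (hall.and (hbig (R + 1))).exists
    obtain ⟨b, hb, hb'⟩ := hne n α' hα'ξ
    have hbR : G.dist x b ≤ R := hR ⟨b, hb, rfl⟩
    have hiff : b ∈ Set.range (α n) ↔ b ∈ Set.range α' := by
      constructor
      · rintro ⟨i, rfl⟩
        by_cases hi : Valid G x (w n) i
        · have h1 := (hα n).dist_zero hi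
          exact ⟨i, (hn i (Finset.mem_range.2 (by omega))).symm⟩
        · have h1 := (hα n).eq_vertex hi
          have h2 := (hnear n).1
          rw [h1] at h2
          have h3 : n ≤ G.dist x (α n i) := h2
          omega
      · rintro ⟨i, rfl⟩
        have h1 := hα'ξ.dist_zero (n := i) trivial
        exact ⟨i, hn i (Finset.mem_range.2 (by omega))⟩
    rcases hb' with h | h
    · exact h.2 (hiff.1 h.1)
    · exact h.1 (hiff.2 h.2)

theorem Delta.isOpen_iff {U : Set (Delta G)} :
    IsOpen U ↔ ∀ x ∈ U, ∃ A : Set V, A.Finite ∧ basicNhd G x A ⊆ U := Iff.rfl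

/-- The points which some geodesic from `x` reaches through `a` form a closed set. -/
theorem UnifFineHyp.isClosed_through (H : UnifFineHyp G δ) (x a : V) :
    IsClosed {z : Delta G | ∃ α, GeoTo G x z α ∧ a ∈ Set.range α} := by
  rw [← isOpen_compl_iff, Delta.isOpen_iff]
  intro z hz
  obtain ⟨A, hA, h⟩ := H.exists_nhd_trace x z (Set.finite_singleton a)
  refine ⟨A, hA, ?_⟩
  rintro w hw ⟨α, hα, ha⟩
  obtain ⟨α', hα', h'⟩ := h w hw α hα
  exact hz ⟨α', hα', (h' a rfl).1 ha⟩

/-- The points which all geodesics from `x` reach through `A` form an open set. -/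
theorem UnifFineHyp.isOpen_forced (H : UnifFineHyp G δ) (x : V) {B : Set V} (hB : B.Finite) :
    IsOpen {z : Delta G | ∀ α, GeoTo G x z α → ∃ b ∈ B, b ∈ Set.range α} := by
  rw [Delta.isOpen_iff]
  intro z hz
  obtain ⟨A, hA, h⟩ := H.exists_nhd_trace x z hB
  refine ⟨A, hA, fun w hw α hα => ?_⟩
  obtain ⟨α', hα', h'⟩ := h w hw α hα
  obtain ⟨b, hb, hb'⟩ := hz α' hα'
  exact ⟨b, hb, (h' b hb).2 hb'⟩

/-- The definition of the topology does not make the sets `basicNhd` open; at a vertex the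
complement is a finite union of sets closed by `isClosed_through`. -/
theorem UnifFineHyp.isOpen_basicNhd_vertex (H : UnifFineHyp G δ) (x : V) {A : Set V}
    (hA : A.Finite) : IsOpen (basicNhd G (.vertex x) A) := by
  have : basicNhd G (.vertex x) A =
      ⋂ a ∈ A \ {x}, {z : Delta G | ∃ α, GeoTo G x z α ∧ a ∈ Set.range α}ᶜ := by
    ext z
    simp only [mem_basicNhd_vertex, Set.mem_iInter, Set.mem_compl_iff, Set.mem_ofPred_eq,
      not_exists, not_and]
    constructor
    · rintro h a ⟨ha, hax⟩ α hα ⟨k, rfl⟩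
      exact hax (h α hα k ha)
    · intro h α hα k hk
      by_contra hne
      exact h _ ⟨hk, hne⟩ α hα ⟨k, rfl⟩
  rw [this]
  exact hA.sdiff.isOpen_biInter fun a _ => (H.isClosed_through x a).isOpen_compl

theorem vertex_mem_basicNhd (x : V) (A : Set V) :
    Delta.vertex x ∈ basicNhd G (.vertex x) A := by
  rw [mem_basicNhd_vertex]
  intro α hα k _
  exact hα.2.2 k (by simp)

/-- Some finite set not containing `x` meets every geodesic from `x` to `z`: the vertex `z` itself,
or the first steps of all rays. Points whose geodesics from `x` avoid it are separated from points
whose geodesics must meet it. -/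
theorem UnifFineHyp.separate_vertex (H : UnifFineHyp G δ) (x : V) {z : Delta G}
    (hz : z ≠ .vertex x) : ∃ U W : Set (Delta G), IsOpen U ∧ IsOpen W ∧ .vertex x ∈ U ∧ z ∈ W ∧
      Disjoint U W := by
  obtain ⟨A, hA, hxA, hzA⟩ : ∃ A : Set V, A.Finite ∧ x ∉ A ∧
      ∀ α, GeoTo G x z α → ∃ b ∈ A, b ∈ Set.range α := by
    cases z with
    | vertex y =>
      refine ⟨{y}, Set.finite_singleton y, fun h => hz (congrArg _ h.symm), fun α hα => ?_⟩
      exact ⟨y, rfl, _, hα.2.2 _ le_rfl⟩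
    | bdry ξ =>
      refine ⟨_, H.slice_finite x ξ 1, ?_, fun α hα => ⟨α 1, ⟨α, hα, rfl⟩, ⟨1, rfl⟩⟩⟩
      rintro ⟨α, hα, h⟩
      have := hα.dist_zero (n := 1) trivial
      rw [h] at this
      simp at this
  refine ⟨_, _, H.isOpen_basicNhd_vertex x hA, H.isOpen_forced x hA, vertex_mem_basicNhd x A,
    hzA, ?_⟩
  rw [Set.disjoint_left]
  intro w hw hw'
  obtain ⟨α, hα⟩ := H.exists_geoTo x w
  obtain ⟨_, hb, k, rfl⟩ := hw' α hα
  have := mem_basicNhd_vertex.1 hw α hα k hb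
  rw [this] at hb
  exact hxA hb

/-- At a time when rays to `ξ` and `ω` are more than `4 * δ` apart, the two finite slices force
disjoint sets: a geodesic through both would pass both at time `n`, bringing the rays within `4 *
δ`. -/
theorem UnifFineHyp.separate_bdry (H : UnifFineHyp G δ) {ξ ω : Boundary G} (hne : ξ ≠ ω) :
    ∃ U W : Set (Delta G), IsOpen U ∧ IsOpen W ∧ .bdry ξ ∈ U ∧ .bdry ω ∈ W ∧ Disjoint U W := by
  obtain ⟨x⟩ := H.conn.nonempty
  obtain ⟨γ, hγ⟩ := H.exists_geoTo x (.bdry ξ)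
  obtain ⟨γ', hγ'⟩ := H.exists_geoTo x (.bdry ω)
  obtain ⟨n, hn⟩ : ∃ n, 4 * δ < G.dist (γ n) (γ' n) := by
    by_contra! hcon
    obtain ⟨-, h1, rfl⟩ := hγ
    obtain ⟨-, h2, rfl⟩ := hγ'
    exact hne ((Boundary.mk_eq_iff H.conn).2 ⟨_, hcon⟩)
  refine ⟨_, _, H.isOpen_forced x (H.slice_finite x ξ n), H.isOpen_forced x (H.slice_finite x ω n),
    fun α hα => ⟨α n, ⟨α, hα, rfl⟩, n, rfl⟩, fun α hα => ⟨α n, ⟨α, hα, rfl⟩, n, rfl⟩, ?_⟩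
  rw [Set.disjoint_left]
  intro w hw hw'
  obtain ⟨μ, hμ⟩ := H.exists_geoTo x w
  obtain ⟨_, ⟨α, hα, rfl⟩, k, hk⟩ := hw μ hμ
  obtain ⟨_, ⟨α', hα', rfl⟩, k', hk'⟩ := hw' μ hμ
  have key : ∀ k v, G.dist x v = n → μ k = v → v = μ n := by
    rintro k _ hv rfl
    by_cases hk : Valid G x w k
    · have h1 := hμ.dist_zero hk
      obtain rfl : k = n := by omega
      rfl
    · have h1 := hμ.eq_vertex hk
      cases w with
      | bdry => exact absurd trivial hk
      | vertex w =>
        obtain rfl := Delta.vertex.inj h1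
        rw [hμ.2.2 n hv.le]
  have h1 := key k _ (hα.dist_zero trivial) hk
  have h2 := key k' _ (hα'.dist_zero trivial) hk'
  have h3 := H.close_same hγ hα n
  have h4 := H.close_same hα' hγ' n
  rw [h2, ← h1] at h4
  have h5 := H.conn.dist_triangle (u := γ n) (v := α n) (w := γ' n)
  rw [SimpleGraph.dist_comm] at h3 h4
  omega

theorem UnifFineHyp.t2Space (H : UnifFineHyp G δ) : T2Space (Delta G) := by
  refine ⟨fun z w hzw => ?_⟩
  cases z with
  | vertex x => exact H.separate_vertex x hzw.symm
  | bdry ξ =>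
    cases w with
    | vertex y =>
      obtain ⟨U, W, h1, h2, h3, h4, h5⟩ := H.separate_vertex y hzw
      exact ⟨W, U, h2, h1, h4, h3, h5.symm⟩
    | bdry ω => exact H.separate_bdry fun h => hzw (congrArg _ h)

theorem le_nhds_of_basicNhd {F : Filter (Delta G)} {z : Delta G}
    (h : ∀ A : Set V, A.Finite → basicNhd G z A ∈ F) : F ≤ nhds z := by
  rw [le_nhds_iff]
  intro s hz hs
  obtain ⟨A, hA, hAs⟩ := Delta.isOpen_iff.1 hs z hz
  exact Filter.mem_of_superset (h A hA) hAs

/-- For an ultrafilter on `Delta G`, consider the vertices at time `k` of chosen geodesics from `x`.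
If they stabilize for every `k`, the limit is the resulting ray's end point, or the vertex at which
the geodesics stop. Otherwise the limit is the last vertex `v` before the first unstable time. -/
theorem UnifFineHyp.compactSpace (H : UnifFineHyp G δ) : CompactSpace (Delta G) := by
  classical
  refine ⟨isCompact_iff_ultrafilter_le_nhds.2 fun U _ => ?_⟩
  suffices ∃ z : Delta G, (U : Filter (Delta G)) ≤ nhds z by
    obtain ⟨z, hz⟩ := this
    exact ⟨z, trivial, hz⟩
  obtain ⟨x⟩ := H.conn.nonempty
  choose β hβ using fun w : Delta G => H.exists_geoTo x w
  by_cases hall : ∀ k, ∃ v, ∀ᶠ w in (U : Filter (Delta G)), β w k = v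
  · choose α hα using hall
    by_cases hvalid : ∀ k, ∀ᶠ w in (U : Filter (Delta G)), Valid G x w k
    · have hray : IsGeodesicRay G α := isGeodesicRay_iff.2 fun i j hij => by
        obtain ⟨w, h1, h2, h3⟩ := ((hα i).and ((hα j).and (hvalid j))).exists
        rw [← h1, ← h2]
        exact (hβ w).seg h3 i j hij le_rfl
      have h0 : α 0 = x := by
        obtain ⟨w, hw⟩ := (hα 0).exists
        rw [← hw, (hβ w).zero]
      refine ⟨.bdry (Boundary.mk α hray), le_nhds_of_basicNhd fun A hA => ?_⟩
      obtain ⟨n, hn⟩ := H.far (x := x) (γ := α) ⟨h0, hray, rfl⟩ hA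
      filter_upwards [hα n, hvalid n] with w h1 h2
      exact hn w _ (hβ w) h2 h1
    · obtain ⟨k, hk⟩ := not_forall.1 hvalid
      rw [← Ultrafilter.eventually_not] at hk
      refine ⟨.vertex (α k), le_nhds_of_basicNhd fun A _ => ?_⟩
      filter_upwards [hα k, hk] with w h1 h2
      rw [(hβ w).eq_vertex h2, h1]
      exact vertex_mem_basicNhd _ _
  · simp only [not_forall, not_exists] at hall
    set k := Nat.find hall
    have hk : ∀ v, ¬ ∀ᶠ w in (U : Filter (Delta G)), β w k = v := Nat.find_spec hall
    have hk0 : k ≠ 0 := by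
      intro h
      rw [h] at hk
      exact hk x (Filter.Eventually.of_forall fun w => (hβ w).zero)
    obtain ⟨v, hv⟩ : ∃ v, ∀ᶠ w in (U : Filter (Delta G)), β w (k - 1) = v := by
      have := Nat.find_min hall (m := k - 1) (by omega)
      simpa only [not_forall, not_not] using this
    have hvalid : ∀ᶠ w in (U : Filter (Delta G)), Valid G x w k := by
      by_contra hcon
      rw [← Ultrafilter.eventually_not] at hcon
      refine hk v ?_
      filter_upwards [hcon, hv] with w h1 h2
      cases w with
      | bdry => exact absurd trivial h1
      | vertex w =>
        have h3 : G.dist x w < k := not_le.1 h1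
        rw [← h2, (hβ (.vertex w)).2.2 k h3.le, (hβ (.vertex w)).2.2 (k - 1) (by omega)]
    refine ⟨.vertex v, le_nhds_of_basicNhd fun A hA => ?_⟩
    -- Were `v` not the limit, almost all points would have geodesics from `v` through one `a` in
    -- `A`, hence with one common first step `b`. By `first_mem_pathHull`, applied to their
    -- continuations from `b`, the next vertex of `β w` after `v` would lie in a finite hull and
    -- stabilize.
    by_contra hcon
    replace hcon : (basicNhd G (.vertex v) A)ᶜ ∈ U := Ultrafilter.compl_mem_iff_notMem.2 hcon
    have h1 : ∀ w ∈ (basicNhd G (.vertex v) A)ᶜ, ∃ τ, GeoTo G v w τ ∧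
        ∃ m, τ m ∈ A ∧ τ m ≠ v := by
      intro w hw
      rw [Set.mem_compl_iff, mem_basicNhd_vertex] at hw
      push Not at hw
      obtain ⟨τ, hτ, m, h1, h2⟩ := hw
      exact ⟨τ, hτ, m, h1, h2⟩
    have : Nonempty V := ⟨x⟩
    choose! τ hτ m hmA hmv using h1
    obtain ⟨a, haA, ha⟩ := exists_eventually_eq U (f := fun w => τ w (m w)) hA (by
      filter_upwards [hcon] with w hw
      exact hmA w hw)
    have hstep : ∀ w ∈ (basicNhd G (.vertex v) A)ᶜ, τ w (m w) = a →
        τ w 1 ∈ pathHull G v a (G.dist v a) ∪ {a} := by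
      rintro w hw rfl
      obtain ⟨i, hi, hi'⟩ : ∃ i, Valid G v w i ∧ τ w i = τ w (m w) := by
        by_cases hm : Valid G v w (m w)
        · exact ⟨_, hm, rfl⟩
        · have := (hτ w hw).eq_vertex hm
          have hτw := hτ w hw
          revert hτw this hm
          generalize τ w (m w) = y
          rintro - rfl hτw
          exact ⟨G.dist v y, le_refl (G.dist v y), hτw.2.2 _ le_rfl⟩
      rw [← hi']
      have h2 := (hτ w hw).dist_zero hi
      have hi0 : i ≠ 0 := by
        rintro rfl
        exact hmv w hw (hi'.symm.trans (hτ w hw).zero)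
      rcases Nat.eq_or_lt_of_le (Nat.one_le_iff_ne_zero.2 hi0) with h3 | h3
      · right
        rw [← h3]
        rfl
      · left
        have := ((hτ w hw).seg hi).mem_pathHull H.conn (s := 0) (l := 1) (t := i) le_rfl
          (p := v) (q := τ w i) (a := 0) (b := 0) (by simp [(hτ w hw).zero]) (by simp) (by omega)
          (by omega) (L := G.dist v (τ w i)) (by omega)
        exact this
    obtain ⟨b, -, hb⟩ := exists_eventually_eq U (f := fun w => τ w 1)
      ((H.hull_finite v a (G.dist v a)).union (Set.finite_singleton a)) (by
        filter_upwards [hcon, ha] with w hw haw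
        exact hstep w hw haw)
    obtain ⟨c, -, hc⟩ := exists_eventually_eq U (f := fun w => β w k)
      (H.hull_finite b v (3 * G.dist b v + 6 * δ + 2)) (by
        filter_upwards [hcon, hb, hv, hvalid] with w hw hbw hvw hval
        have hval' : Valid G x w (k - 1 + 1) := by rwa [Nat.sub_add_cancel (by omega)]
        have h2 := (hβ w).shift H.conn (k := k - 1) (hval.mono (by omega))
        have h3 := (hβ w).valid_shift (k := k - 1) hval'
        rw [hvw] at h2 h3
        have h4 := (hτ w hw).shift H.conn h3
        rw [hbw] at h4
        have h5 : v ∉ Set.range fun i => τ w (1 + i) := by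
          rintro ⟨i, hi⟩
          dsimp only at hi
          by_cases hvi : Valid G v w (1 + i)
          · have h6 := (hτ w hw).dist_zero hvi
            rw [hi] at h6
            simp at h6
            omega
          · have h6 := (hτ w hw).eq_vertex hvi
            rw [hi] at h6
            rw [h6] at h3
            have : 1 ≤ G.dist v v := h3
            simp at this
        have h6 := H.first_mem_pathHull h4 h5 h2 h3 le_rfl
        rwa [Nat.sub_add_cancel (by omega)] at h6)
    exact hk c hc

end DeltaTopology

/-! ### The action on `Delta G` -/

section DeltaAction

variable {V : Type u} {Γ : Type v} [Group Γ] [MulAction Γ V] {G : SimpleGraph V} [ActsOnGraph Γ G]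

theorem smul_mem_geodesicSets (g : Γ) {z w : Delta G} {S : Set V} (hS : S ∈ geodesicSets G z w) :
    (fun x => g • x) '' S ∈ geodesicSets G (g • z) (g • w) := by
  have hmk : ∀ (α : ℕ → V) (h : IsGeodesicRay G α), ∃ h' : IsGeodesicRay G (fun n => g • α n),
      Boundary.mk _ h' = Boundary.smul g (Boundary.mk α h) := fun α h =>
    ⟨fun i j => by rw [dist_smul]; exact h i j, rfl⟩
  cases z with
  | vertex x =>
    cases w with
    | vertex y =>
      obtain ⟨n, α, hα, rfl, rfl, rfl⟩ := hS
      refine ⟨n, fun k => g • α k, fun i hi j hj => by rw [dist_smul]; exact hα i hi j hj, rfl, rfl,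
        ?_⟩
      rw [Set.image_image]
    | bdry ξ =>
      obtain ⟨α, h, rfl, rfl, rfl⟩ := hS
      obtain ⟨h', e⟩ := hmk α h
      exact ⟨_, h', rfl, e, (Set.range_comp _ _).symm⟩
  | bdry ξ =>
    cases w with
    | vertex y =>
      obtain ⟨α, h, rfl, rfl, rfl⟩ := hS
      obtain ⟨h', e⟩ := hmk α h
      exact ⟨_, h', rfl, e, (Set.range_comp _ _).symm⟩
    | bdry ω =>
      obtain ⟨α, h, rfl, rfl, rfl⟩ := hS
      exact ⟨fun n => g • α n, fun i j => by rw [dist_smul]; exact h i j, rfl, rfl,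
        (Set.range_comp _ _).symm⟩

theorem smul_mem_basicNhd (g : Γ) {z w : Delta G} {A : Set V}
    (hw : w ∈ basicNhd G z ((fun x => g • x) ⁻¹' A)) : g • w ∈ basicNhd G (g • z) A := by
  intro S hS a ha haz haS
  have h1 := smul_mem_geodesicSets g⁻¹ hS
  rw [inv_smul_smul, inv_smul_smul] at h1
  refine hw _ h1 (g⁻¹ • a) (by simpa using ha) ?_ ⟨a, haS, rfl⟩
  rintro rfl
  refine haz ?_
  show _ = Delta.vertex (g • g⁻¹ • a)
  rw [smul_inv_smul]

instance Delta.continuousConstSMul : ContinuousConstSMul Γ (Delta G) := by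
  refine ⟨fun g => ⟨fun O hO => ?_⟩⟩
  rw [Delta.isOpen_iff]
  intro z hz
  obtain ⟨A, hA, hAO⟩ := Delta.isOpen_iff.1 hO _ hz
  exact ⟨_, hA.preimage (MulAction.injective g).injOn, fun w hw => hAO (smul_mem_basicNhd g hw)⟩

theorem GeoTo.smul (g : Γ) {x : V} {z : Delta G} {α : ℕ → V} (h : GeoTo G x z α) :
    GeoTo G (g • x) (g • z) (fun n => g • α n) := by
  cases z with
  | vertex y =>
    obtain ⟨rfl, h1, h2⟩ := h
    refine ⟨rfl, ?_, ?_⟩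
    · rw [dist_smul]
      intro i j hij hj
      rw [dist_smul]
      exact h1 i j hij hj
    · intro k hk
      rw [dist_smul] at hk
      dsimp only
      rw [h2 k hk]
  | bdry ξ =>
    obtain ⟨rfl, h1, rfl⟩ := h
    exact ⟨rfl, fun i j => by rw [dist_smul]; exact h1 i j, rfl⟩

end DeltaAction


/-! ### Averages of uniform densities -/

section Average

variable {V : Type u}

/-- The uniform probability density on a finite set. -/
noncomputable def unif (A : Set V) : V → ℝ := A.indicator fun _ => (A.ncard : ℝ)⁻¹

/-- The average of the uniform densities on the sets `S n, …, S (2 n - 1)`. -/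
noncomputable def avgUnif (S : ℕ → Set V) (n : ℕ) (v : V) : ℝ :=
  (∑ i ∈ Finset.range n, unif (S (n + i)) v) / n

theorem unif_nonneg (A : Set V) (v : V) : 0 ≤ unif A v :=
  Set.indicator_nonneg (fun _ _ => by positivity) v

theorem avgUnif_nonneg (S : ℕ → Set V) (n : ℕ) (v : V) : 0 ≤ avgUnif S n v :=
  div_nonneg (Finset.sum_nonneg fun _ _ => unif_nonneg _ _) (by positivity)

theorem hasSum_indicator_const {A : Set V} (hA : A.Finite) (c : ℝ) :
    HasSum (A.indicator fun _ => c) (A.ncard * c) := by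
  have : HasSum (A.indicator fun _ => c) (∑ v ∈ hA.toFinset, A.indicator (fun _ => c) v) :=
    hasSum_sum_of_ne_finset_zero (fun v hv => Set.indicator_of_notMem (by simpa using hv) _)
  convert this using 1
  rw [Finset.sum_congr rfl (g := fun _ => c)
    (fun v hv => Set.indicator_of_mem (by simpa using hv) _), Finset.sum_const,
    Set.ncard_eq_toFinset_card A hA, nsmul_eq_mul]

theorem hasSum_unif {A : Set V} (hA : A.Finite) (hne : A.Nonempty) : HasSum (unif A) 1 := by
  have h := hasSum_indicator_const hA (A.ncard : ℝ)⁻¹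
  rwa [mul_inv_cancel₀] at h
  exact_mod_cast ((Set.ncard_pos hA).2 hne).ne'

theorem hasSum_avgUnif {S : ℕ → Set V} {n : ℕ} (hn : 0 < n)
    (hS : ∀ i < n, (S (n + i)).Finite ∧ (S (n + i)).Nonempty) : HasSum (avgUnif S n) 1 := by
  have h := (hasSum_sum (s := Finset.range n) (f := fun i => unif (S (n + i))) (a := fun _ => 1)
    fun i hi => hasSum_unif (hS i (Finset.mem_range.1 hi)).1
      (hS i (Finset.mem_range.1 hi)).2).div_const (n : ℝ)
  simp only [Finset.sum_const, Finset.card_range, nsmul_eq_mul, mul_one] at h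
  rwa [div_self (by exact_mod_cast hn.ne')] at h

/-- Both densities are at least `1 / |Q|` on `P`, so their distance is at most `2 (1 - |P| / |Q|)`.
The logarithmic bound is weaker but telescopes. -/
theorem tsum_abs_unif_sub_le {P A B Q : Set V} (hQ : Q.Finite) (hP : P.Nonempty) (hPA : P ⊆ A)
    (hPB : P ⊆ B) (hAQ : A ⊆ Q) (hBQ : B ⊆ Q) :
    ∑' v, |unif A v - unif B v| ≤ 2 * (Real.log Q.ncard - Real.log P.ncard) := by
  have hPQ : P ⊆ Q := hPA.trans hAQ
  have hPf := hQ.subset hPQ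
  have hAf := hQ.subset hAQ
  have hBf := hQ.subset hBQ
  have hpos : ∀ C : Set V, C.Finite → P ⊆ C → (0 : ℝ) < C.ncard := fun C hC h => by
    exact_mod_cast (Set.ncard_pos hC).2 (hP.mono h)
  have hA := hasSum_unif hAf (hP.mono hPA)
  have hB := hasSum_unif hBf (hP.mono hPB)
  have hR := (hA.add hB).sub ((hasSum_indicator_const hPf (Q.ncard : ℝ)⁻¹).mul_left 2)
  have hle : ∀ v, |unif A v - unif B v| ≤
      unif A v + unif B v - 2 * P.indicator (fun _ => (Q.ncard : ℝ)⁻¹) v := by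
    intro v
    have h1 : ∀ C : Set V, P ⊆ C → C ⊆ Q → P.indicator (fun _ => (Q.ncard : ℝ)⁻¹) v ≤ unif C v := by
      intro C hPC hCQ
      by_cases hv : v ∈ P
      · rw [Set.indicator_of_mem hv, unif, Set.indicator_of_mem (hPC hv)]
        exact inv_anti₀ (hpos C (hQ.subset hCQ) hPC) (by exact_mod_cast Set.ncard_le_ncard hCQ hQ)
      · rw [Set.indicator_of_notMem hv]
        exact unif_nonneg _ _
    have h2 := h1 A hPA hAQ
    have h3 := h1 B hPB hBQ
    rw [abs_le]
    constructor <;> linarith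
  have hs : Summable fun v => |unif A v - unif B v| := (hA.summable.sub hB.summable).abs
  have h1 := hasSum_le hle hs.hasSum hR
  have h2 := Real.one_sub_inv_le_log_of_pos (div_pos (hpos Q hQ hPQ) (hpos P hPf le_rfl))
  rw [Real.log_div (hpos Q hQ hPQ).ne' (hpos P hPf le_rfl).ne', inv_div, div_eq_mul_inv] at h2
  linarith

theorem sum_shift_sub_le {f : ℕ → ℝ} {n p : ℕ} {M : ℝ} (h0 : ∀ i, 0 ≤ f i)
    (hM : ∀ i ≤ n + p, f i ≤ M) :
    ∑ i ∈ Finset.range n, (f (i + p) - f i) ≤ p * M := by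
  induction p with
  | zero => simp
  | succ p ih =>
    have h1 : ∑ i ∈ Finset.range n, (f (i + (p + 1)) - f i) =
        ∑ i ∈ Finset.range n, (f (i + p) - f i) +
          ∑ i ∈ Finset.range n, (f (i + 1 + p) - f (i + p)) := by
      rw [← Finset.sum_add_distrib]
      refine Finset.sum_congr rfl fun i _ => ?_
      rw [show i + (p + 1) = i + 1 + p by ring]
      ring
    rw [h1, Finset.sum_range_sub (fun i => f (i + p))]
    have h2 := ih fun i hi => hM i (by omega)
    have h3 := hM (n + p) (by omega)
    have h4 := h0 (0 + p)
    push_cast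
    linarith

/-- Each pair `S k`, `S' k` lies between `S (k - m)` and `S (k + m)`. Summing the logarithmic bounds
over `k` telescopes to about `2m` terms `log M`, so after division by `n` growth slower than
exponential suffices. -/
theorem tsum_abs_avgUnif_sub_le {S S' : ℕ → Set V} {m n : ℕ} (hn : 0 < n) (hmn : m ≤ n) {M : ℝ}
    (hfin : ∀ k ≤ 3 * n, (S k).Finite ∧ ((S k).ncard : ℝ) ≤ M)
    (hmono : ∀ k ≤ 3 * n, ∀ l ≤ k, S l ⊆ S k) (hne : ∀ k, (S k).Nonempty)
    (h₁ : ∀ k, S k ⊆ S' (k + m)) (h₂ : ∀ k, S' k ⊆ S (k + m)) :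
    ∑' v, |avgUnif S n v - avgUnif S' n v| ≤ 4 * m * Real.log M / n := by
  have hn' : (0 : ℝ) < n := by exact_mod_cast hn
  have hfin' : ∀ i < n, (S' (n + i)).Finite ∧ (S' (n + i)).Nonempty := fun i hi => by
    refine ⟨(hfin (n + i + m) (by omega)).1.subset (h₂ _), ?_⟩
    have := h₁ (n + i - m)
    rw [Nat.sub_add_cancel (by omega)] at this
    exact (hne _).mono this
  have hfin₁ : ∀ i < n, (S (n + i)).Finite ∧ (S (n + i)).Nonempty := fun i hi =>
    ⟨(hfin _ (by omega)).1, hne _⟩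
  have hsum : ∀ i ∈ Finset.range n, Summable fun v => |unif (S (n + i)) v - unif (S' (n + i)) v| :=
    fun i hi => by
      have hi' := Finset.mem_range.1 hi
      exact ((hasSum_unif (hfin₁ i hi').1 (hfin₁ i hi').2).summable.sub
        (hasSum_unif (hfin' i hi').1 (hfin' i hi').2).summable).abs
  have hpt : ∀ v, |avgUnif S n v - avgUnif S' n v| ≤
      (∑ i ∈ Finset.range n, |unif (S (n + i)) v - unif (S' (n + i)) v|) / n := by
    intro v
    rw [avgUnif, avgUnif, ← sub_div, ← Finset.sum_sub_distrib, abs_div, abs_of_pos hn']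
    gcongr
    exact Finset.abs_sum_le_sum_abs _ _
  have hs : Summable fun v => |avgUnif S n v - avgUnif S' n v| :=
    ((hasSum_avgUnif hn hfin₁).summable.sub (hasSum_avgUnif hn hfin').summable).abs
  have h3 := hasSum_le hpt hs.hasSum ((hasSum_sum fun i hi => (hsum i hi).hasSum).div_const (n : ℝ))
  refine h3.trans ?_
  gcongr
  set f : ℕ → ℝ := fun i => Real.log (S (n - m + i)).ncard with hf
  have h4 : ∀ i ∈ Finset.range n, ∑' v, |unif (S (n + i)) v - unif (S' (n + i)) v| ≤
      2 * (f (i + 2 * m) - f i) := by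
    intro i hi
    have hi' := Finset.mem_range.1 hi
    have e1 : n - m + (i + 2 * m) = n + i + m := by omega
    have e2 : n - m + i + m = n + i := by omega
    have e3 := h₁ (n - m + i)
    rw [e2] at e3
    simp only [hf, e1]
    exact tsum_abs_unif_sub_le (hfin _ (by omega)).1 (hne _) (hmono _ (by omega) _ (by omega)) e3
      (hmono _ (by omega) _ (by omega)) (h₂ _)
  refine (Finset.sum_le_sum h4).trans ?_
  rw [← Finset.mul_sum]
  have h5 := sum_shift_sub_le (f := f) (n := n) (p := 2 * m) (M := Real.log M)
    (fun i => Real.log_natCast_nonneg _) (fun i hi => by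
      have h6 := (hfin (n - m + i) (by omega))
      refine Real.log_le_log ?_ h6.2
      exact_mod_cast (Set.ncard_pos h6.1).2 (hne _))
  push_cast at h5
  linarith

end Average

/-! ### Borel almost equivariant densities on the vertices -/

section Reach

variable {V : Type u} {G : SimpleGraph V} {δ : ℕ}

/-- The points reached at time `l` by the geodesics to `z` that start in the `k`-ball at `x`. -/
def reach (G : SimpleGraph V) (x : V) (z : Delta G) (l k : ℕ) : Set V :=
  {v | ∃ y β, G.dist x y ≤ k ∧ GeoTo G y z β ∧ β l = v}

theorem reach_mono {x : V} {z : Delta G} {l k k' : ℕ} (h : k ≤ k') :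
    reach G x z l k ⊆ reach G x z l k' := by
  rintro v ⟨y, β, h1, h2, h3⟩
  exact ⟨y, β, h1.trans h, h2, h3⟩

theorem reach_subset (hconn : G.Connected) {x x' : V} {z : Delta G} {l k m : ℕ}
    (h : G.dist x x' ≤ m) : reach G x z l k ⊆ reach G x' z l (k + m) := by
  rintro v ⟨y, β, h1, h2, h3⟩
  refine ⟨y, β, ?_, h2, h3⟩
  have := hconn.dist_triangle (u := x') (v := x) (w := y)
  rw [SimpleGraph.dist_comm (u := x') (v := x)] at this
  omega

theorem UnifFineHyp.reach_nonempty (H : UnifFineHyp G δ) (x : V) (z : Delta G) (l k : ℕ) :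
    (reach G x z l k).Nonempty := by
  obtain ⟨α, hα⟩ := H.exists_geoTo x z
  exact ⟨α l, x, α, by simp, hα, rfl⟩

theorem smul_reach {Γ : Type v} [Group Γ] [MulAction Γ V] [ActsOnGraph Γ G] (g : Γ) {x v : V}
    {z : Delta G} {l k : ℕ} (h : v ∈ reach G x z l k) :
    g • v ∈ reach G (g • x) (g • z) l k := by
  obtain ⟨y, β, h1, h2, rfl⟩ := h
  exact ⟨g • y, fun n => g • β n, by rwa [dist_smul], h2.smul g, rfl⟩

theorem encard_biUnion_range_le {X : Type*} (S : ℕ → Set X) (n C : ℕ)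
    (h : ∀ i, (S i).encard ≤ C) : (⋃ i ∈ Finset.range n, S i).encard ≤ (n * C : ℕ) := by
  induction n with
  | zero => simp
  | succ n ih =>
    rw [Finset.range_add_one, Finset.set_biUnion_insert]
    refine (Set.encard_union_le _ _).trans ?_
    rw [add_mul, one_mul, add_comm (n * C), Nat.cast_add]
    exact add_le_add (h n) ih

/-- Every geodesic from the `k`-ball follows one fixed `α` with a shift in `[-k, k]`. Each shift
puts the point at time `l` in a path hull between two points of `α`, or between one and the end
point, or at the end point itself. The bound does not depend on `l`. -/
theorem UnifFineHyp.exists_encard_reach_le (H : UnifFineHyp G δ) :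
    ∃ C : ℕ, ∀ x (z : Delta G) l k, k + 2 * δ + 1 ≤ l →
      (reach G x z l k).encard ≤ ((2 * k + 1) * C : ℕ) := by
  obtain ⟨C, hC⟩ := H.hull (8 * δ + 2)
  refine ⟨C + C + 1, fun x z l k hkl => ?_⟩
  obtain ⟨α, hα⟩ := H.exists_geoTo x z
  -- `w` is the end point if that is a vertex, and a dummy otherwise.
  obtain ⟨w, hw⟩ : ∃ w, ∀ w', z = .vertex w' → w = w' := by
    cases z with
    | vertex w => exact ⟨w, fun w' h => Delta.vertex.inj h⟩
    | bdry ξ => exact ⟨x, fun w' h => by simp at h⟩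
  set p : ℕ → V := fun i => α (l - (2 * δ + 1) - k + i) with hp
  set q : ℕ → V := fun i => α (l + (2 * δ + 1) - k + i) with hq
  refine le_trans (Set.encard_le_encard (t := ⋃ i ∈ Finset.range (2 * k + 1),
    (pathHull G (p i) (q i) (8 * δ + 2) ∪ pathHull G (p i) w (8 * δ + 2) ∪ {w})) ?_)
    (encard_biUnion_range_le _ _ _ fun i => ?_)
  · rintro _ ⟨y, β, hy, hβ, rfl⟩
    obtain ⟨c, hc1, hc2, hc⟩ := H.close hα hβ (l + (2 * δ + 1))
    obtain ⟨i, hi⟩ : ∃ i : ℕ, (i : ℤ) = c + k := ⟨(c + k).toNat, by omega⟩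
    simp only [Set.mem_iUnion]
    refine ⟨i, Finset.mem_range.2 (by omega), ?_⟩
    have h0 : Valid G y z (l - (2 * δ + 1)) → G.dist (p i) (β (l - (2 * δ + 1))) ≤ 2 * δ := by
      intro hv
      rw [SimpleGraph.dist_comm]
      exact hc _ _ (by omega) (by omega) hv (by omega)
    by_cases h1 : Valid G y z (l + (2 * δ + 1))
    · left; left
      refine (hβ.seg h1).mem_pathHull H.conn le_rfl (s := l - (2 * δ + 1)) (a := 2 * δ)
        (b := 2 * δ) (h0 (h1.mono (by omega))) ?_ (by omega) (by omega) (by omega)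
      rw [SimpleGraph.dist_comm]
      exact hc _ _ (by omega) (by omega) h1 (by omega)
    · cases z with
      | bdry ξ => exact absurd trivial h1
      | vertex w' =>
        obtain rfl := hw w' rfl
        have h2 : G.dist y w < l + (2 * δ + 1) := not_le.1 h1
        rcases le_or_gt (G.dist y w) l with h3 | h3
        · right
          exact hβ.2.2 l h3
        · left; right
          refine hβ.2.1.mem_pathHull H.conn le_rfl (s := l - (2 * δ + 1)) (a := 2 * δ)
            (b := 0) (h0 ?_) ?_ (by omega) (by omega) (by omega)
          · show l - (2 * δ + 1) ≤ G.dist y w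
            omega
          · rw [hβ.2.2 _ le_rfl]
            simp
  · refine (Set.encard_union_le _ _).trans ?_
    push_cast
    refine add_le_add ((Set.encard_union_le _ _).trans (add_le_add (hC _ _) (hC _ _))) ?_
    simp

/-- For each starting point `y` the set is closed: all points reached through `v`, only `v`, or
empty, according as the distance from `y` to `v` equals, is less than, or exceeds `l`. Balls may be
infinite, so only a countable union of closed sets results. -/
theorem UnifFineHyp.measurableSet_mem_reach (H : UnifFineHyp G δ) [Countable V]
    [MeasurableSpace (Delta G)] [BorelSpace (Delta G)] (x v : V) (l k : ℕ) :
    MeasurableSet {z : Delta G | v ∈ reach G x z l k} := by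
  have := H.t2Space
  have h : {z : Delta G | v ∈ reach G x z l k} =
      ⋃ y : V, ⋃ (_ : G.dist x y ≤ k), {z | ∃ β, GeoTo G y z β ∧ β l = v} := by
    ext z
    simp only [reach, Set.mem_ofPred_eq, Set.mem_iUnion]
    constructor
    · rintro ⟨y, β, h1, h2⟩
      exact ⟨y, h1, β, h2⟩
    · rintro ⟨y, h1, β, h2⟩
      exact ⟨y, β, h1, h2⟩
  rw [h]
  refine MeasurableSet.iUnion fun y => MeasurableSet.iUnion fun _ => ?_
  rcases lt_trichotomy (G.dist y v) l with hl | hl | hl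
  · refine (IsClosed.measurableSet (s := {.vertex v}) isClosed_singleton).congr ?_
    ext z
    constructor
    · rintro rfl
      obtain ⟨β, hβ⟩ := H.exists_geoTo y (.vertex v)
      exact ⟨β, hβ, hβ.2.2 _ hl.le⟩
    · rintro ⟨β, hβ, rfl⟩
      by_cases hv : Valid G y z l
      · have := hβ.dist_zero hv
        omega
      · exact hβ.eq_vertex hv
  · convert (H.isClosed_through y v).measurableSet using 1
    ext z
    constructor
    · rintro ⟨β, hβ, h⟩
      exact ⟨β, hβ, l, h⟩
    · rintro ⟨β, hβ, i, rfl⟩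
      refine ⟨β, hβ, ?_⟩
      by_cases hv : Valid G y z i
      · have := hβ.dist_zero hv
        rw [← hl, this]
      · have h1 := hβ.eq_vertex hv
        cases z with
        | bdry => exact absurd trivial hv
        | vertex w =>
          obtain rfl := Delta.vertex.inj h1
          exact hβ.2.2 l hl.le
  · convert MeasurableSet.empty using 1
    refine Set.eq_empty_of_forall_notMem ?_
    rintro z ⟨β, hβ, rfl⟩
    by_cases hv : Valid G y z l
    · have := hβ.dist_zero hv
      omega
    · have h1 := hβ.eq_vertex hv
      subst h1
      exact hv hl.le

theorem measurable_unif {X : Type*} [MeasurableSpace X] [Countable V] {A : X → Set V}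
    (hA : ∀ v, MeasurableSet {z | v ∈ A z}) (hfin : ∀ z, (A z).Finite) (v : V) :
    Measurable fun z => unif (A z) v := by
  classical
  have hcard : Measurable fun z => ((A z).ncard : ℝ) := by
    have h1 : (fun z => ((A z).ncard : ℝ)) =
        fun z => (∑' v, (A z).indicator (fun _ => (1 : ENNReal)) v).toReal := by
      ext z
      rw [← tsum_subtype, ENNReal.tsum_set_one, ← (hfin z).cast_ncard_eq]
      simp
    rw [h1]
    refine (Measurable.tsum fun v => ?_).ennreal_toReal
    exact (measurable_const.indicator (hA v))
  have h2 : (fun z => unif (A z) v) = {z | v ∈ A z}.indicator fun z => ((A z).ncard : ℝ)⁻¹ := by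
    ext z
    by_cases hv : v ∈ A z
    · rw [unif, Set.indicator_of_mem hv, Set.indicator_of_mem (by exact hv)]
    · rw [unif, Set.indicator_of_notMem hv, Set.indicator_of_notMem (by exact hv)]
  rw [h2]
  exact hcard.inv.indicator (hA v)

/-- Measurable almost equivariant families of probability densities on the vertices. -/
theorem UnifFineHyp.exists_measurable_almost_equivariant (H : UnifFineHyp G δ) [Countable V]
    [MeasurableSpace (Delta G)] [BorelSpace (Delta G)]
    {Γ : Type v} [Group Γ] [MulAction Γ V] [ActsOnGraph Γ G] (E : Finset Γ) {ε : ℝ} (hε : 0 < ε) :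
    ∃ η : Delta G → V → ℝ, (∀ v, Measurable fun z => η z v) ∧ (∀ z v, 0 ≤ η z v) ∧
      (∀ z, HasSum (η z) 1) ∧
      ∀ s ∈ E, ∀ z : Delta G, ∑' v, |η z (s⁻¹ • v) - η (s • z) v| ≤ ε := by
  obtain ⟨C, hC⟩ := H.exists_encard_reach_le
  obtain ⟨x⟩ := H.conn.nonempty
  set m := E.sup fun s => G.dist (s • x) x with hm
  obtain ⟨n, hn0, hmn, hn⟩ : ∃ n : ℕ, 0 < n ∧ m ≤ n ∧
      4 * m * Real.log ((2 * (3 * n) + 1) * C : ℕ) / n ≤ ε := by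
    -- From `log u ≤ 2√u` with `u = 7 * C * n` it is enough that `8m √(7Cn) ≤ ε n`, that is, `a ≤
    -- n`.
    set a : ℝ := (8 * m) ^ 2 * (7 * C) / ε ^ 2 with ha
    have ha0 : 0 ≤ a := by positivity
    refine ⟨⌈a⌉₊ + m + 1, by omega, by omega, ?_⟩
    set n := ⌈a⌉₊ + m + 1 with hn
    have hn1 : (1 : ℝ) ≤ n := by exact_mod_cast (by omega : 1 ≤ n)
    have han : a ≤ n := (Nat.le_ceil a).trans (by exact_mod_cast (by omega : ⌈a⌉₊ ≤ n))
    have hle : (((2 * (3 * n) + 1) * C : ℕ) : ℝ) ≤ 7 * C * n := by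
      push_cast
      nlinarith [(Nat.cast_nonneg C : (0 : ℝ) ≤ C)]
    have hlog : Real.log ((2 * (3 * n) + 1) * C : ℕ) ≤ 2 * √(7 * C * n) := by
      rcases Nat.eq_zero_or_pos ((2 * (3 * n) + 1) * C) with h0 | h0
      · rw [h0, Nat.cast_zero, Real.log_zero]
        positivity
      · have h1 : (0 : ℝ) < ((2 * (3 * n) + 1) * C : ℕ) := by exact_mod_cast h0
        have h2 : (0 : ℝ) < 7 * C * n := h1.trans_le hle
        have h3 := Real.log_le_log h1 hle
        have h4 := Real.log_le_sub_one_of_pos (Real.sqrt_pos.2 h2)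
        rw [Real.log_sqrt h2.le] at h4
        linarith
    rw [div_le_iff₀ (by linarith)]
    have h5 : 4 * m * Real.log ((2 * (3 * n) + 1) * C : ℕ) ≤ 8 * m * √(7 * C * n) := by
      have : (0 : ℝ) ≤ 4 * m := by positivity
      nlinarith
    refine h5.trans ?_
    refine abs_le_of_sq_le_sq' ?_ (by positivity) |>.2
    rw [mul_pow, Real.sq_sqrt (by positivity)]
    rw [ha, div_le_iff₀ (by positivity)] at han
    nlinarith
  set l := 3 * n + 2 * δ + 1 with hl
  have hfin : ∀ (y : V) (z : Delta G), ∀ k ≤ 3 * n, (reach G y z l k).Finite ∧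
      ((reach G y z l k).ncard : ℝ) ≤ ((2 * (3 * n) + 1) * C : ℕ) := by
    intro y z k hk
    have h1 := hC y z l k (by omega)
    have h2 := Set.finite_of_encard_le_coe h1
    refine ⟨h2, ?_⟩
    rw [← h2.cast_ncard_eq] at h1
    have h3 : (reach G y z l k).ncard ≤ (2 * k + 1) * C := by exact_mod_cast h1
    exact_mod_cast h3.trans (Nat.mul_le_mul_right _ (by omega))
  refine ⟨fun z => avgUnif (fun k => reach G x z l k) n, fun v => ?_,
    fun z v => avgUnif_nonneg _ _ _, fun z => ?_, fun s hs z => ?_⟩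
  · refine (Finset.measurable_sum _ fun i hi => ?_).div_const _
    have := Finset.mem_range.1 hi
    exact measurable_unif (fun v => H.measurableSet_mem_reach x v l (n + i))
      (fun z => (hfin x z (n + i) (by omega)).1) v
  · exact hasSum_avgUnif hn0 fun i hi => ⟨(hfin x z _ (by omega)).1, H.reach_nonempty _ _ _ _⟩
  · have hd : G.dist (s • x) x ≤ m := Finset.le_sup (f := fun s => G.dist (s • x) x) hs
    -- Translation by `s` carries the densities based at `x` to those based at `s • x`, so the
    -- defect is only the effect of changing the base vertex.
    have hequi : ∀ v, avgUnif (fun k => reach G x z l k) n (s⁻¹ • v) =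
        avgUnif (fun k => reach G (s • x) (s • z) l k) n v := by
      intro v
      unfold avgUnif
      congr 1
      refine Finset.sum_congr rfl fun i _ => ?_
      have himg : reach G (s • x) (s • z) l (n + i) =
          (fun v => s • v) '' reach G x z l (n + i) := by
        ext u
        constructor
        · intro hu
          have := smul_reach s⁻¹ hu
          rw [inv_smul_smul, inv_smul_smul] at this
          exact ⟨_, this, smul_inv_smul s u⟩
        · rintro ⟨u, hu, rfl⟩
          exact smul_reach s hu
      have hmem : s⁻¹ • v ∈ reach G x z l (n + i) ↔ v ∈ reach G (s • x) (s • z) l (n + i) := by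
        rw [himg]
        constructor
        · intro h
          exact ⟨_, h, smul_inv_smul s v⟩
        · rintro ⟨u, hu, rfl⟩
          simpa using hu
      have hcard : (reach G (s • x) (s • z) l (n + i)).ncard = (reach G x z l (n + i)).ncard := by
        rw [himg]
        exact Set.ncard_image_of_injective _ (MulAction.injective s)
      unfold unif
      by_cases h : s⁻¹ • v ∈ reach G x z l (n + i)
      · rw [Set.indicator_of_mem h, Set.indicator_of_mem (hmem.1 h), hcard]
      · rw [Set.indicator_of_notMem h, Set.indicator_of_notMem (fun h' => h (hmem.2 h'))]
    simp only [hequi]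
    refine (tsum_abs_avgUnif_sub_le hn0 hmn (fun k hk => hfin _ _ k hk)
      (fun k _ l hl => reach_mono hl) (fun k => H.reach_nonempty _ _ _ _)
      (fun k => reach_subset H.conn hd) (fun k => reach_subset H.conn ?_)).trans hn
    rwa [SimpleGraph.dist_comm]

end Reach


/-! ### Separation of convex sets of continuous functions by measures -/

section Separation

open MeasureTheory

variable {X : Type*} [TopologicalSpace X] [CompactSpace X] [T2Space X] [MeasurableSpace X]
  [BorelSpace X]

open CompactlySupported in
/-- A positive functional on the continuous functions is given by a regular measure. -/
theorem exists_measure_of_nonneg (f : StrongDual ℝ C(X, ℝ)) (hf : ∀ g : C(X, ℝ), 0 ≤ g → 0 ≤ f g) :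
    ∃ m : Measure X, IsFiniteMeasure m ∧ m.Regular ∧ ∀ g : C(X, ℝ), ∫ x, g x ∂m = f g := by
  let Λ : C_c(X, ℝ) →ₚ[ℝ] ℝ :=
  { toFun g := f g.toContinuousMap
    map_add' g g' := f.map_add _ _
    map_smul' c g := f.map_smul _ _
    monotone' g g' hgg' := by
      have h := hf (g'.toContinuousMap - g.toContinuousMap) (fun x => sub_nonneg.2 (hgg' x))
      rw [map_sub] at h
      exact sub_nonneg.1 h }
  refine ⟨RealRMK.rieszMeasure Λ, inferInstance, inferInstance, fun g => ?_⟩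
  exact RealRMK.integral_rieszMeasure Λ ⟨g, HasCompactSupport.of_compactSpace _⟩

/-- If a convex set of continuous functions has, for every measure, a member with integral less than
that of the constant `c`, then it has a member less than `c` everywhere. -/
theorem exists_forall_lt_of_forall_integral_lt {Q : Set C(X, ℝ)} (hQ : Convex ℝ Q)
    (hQne : Q.Nonempty) {c : ℝ} (hc : 0 < c)
    (h : ∀ m : Measure X, IsFiniteMeasure m → m.Regular → m ≠ 0 →
      ∃ g ∈ Q, ∫ x, g x ∂m < c * m.real Set.univ) :
    ∃ g ∈ Q, ∀ x, g x < c := by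
  by_contra! hcon
  -- If no member of `Q` lies below `c`, a functional separates `Q` from the open convex set `O`. It
  -- is positive because `O` is stable under subtracting nonnegative functions, so it is a measure.
  set O : Set C(X, ℝ) := {g | ∀ x, g x < c} with hO
  have hOo : IsOpen O := by
    have := ContinuousMap.isOpen_setOfPred_mapsTo (X := X) (Y := ℝ) isCompact_univ
      (isOpen_Iio (a := c))
    simpa [Set.MapsTo, hO] using this
  have hOc : Convex ℝ O := by
    intro g hg g' hg' a b ha hb hab x
    exact convex_Iio c (hg x) (hg' x) ha hb hab
  have hdisj : Disjoint O Q := by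
    rw [Set.disjoint_left]
    intro g hg hgQ
    obtain ⟨x, hx⟩ := hcon g hgQ
    exact absurd (hg x) (not_lt.2 hx)
  obtain ⟨f, u, hfO, hfQ⟩ := geometric_hahn_banach_open hOc hOo hQ hdisj
  have hu : 0 < u := by
    have := hfO 0 (fun x => hc)
    rwa [map_zero] at this
  have hpos : ∀ g : C(X, ℝ), 0 ≤ g → 0 ≤ f g := by
    intro g hg
    by_contra! hneg
    have := hfO (-(u / (-f g)) • g) (fun x => by
      have h1 : 0 ≤ u / (-f g) := div_nonneg hu.le (by linarith)
      have h2 : 0 ≤ g x := hg x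
      simp only [ContinuousMap.smul_apply, smul_eq_mul]
      nlinarith)
    rw [map_smul, smul_eq_mul] at this
    have h3 : -(u / (-f g)) * f g = u := by
      have : f g ≠ 0 := hneg.ne
      field_simp
    linarith
  obtain ⟨m, hm1, hm2, hm⟩ := exists_measure_of_nonneg f hpos
  have hm0 : m ≠ 0 := by
    rintro rfl
    obtain ⟨g, hg⟩ := hQne
    have := hfQ g hg
    rw [← hm g] at this
    simp at this
    linarith
  obtain ⟨g, hgQ, hg⟩ := h m hm1 hm2 hm0
  have h1 := hfQ g hgQ
  rw [hm g] at hg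
  have h2 : m.real Set.univ = f 1 := by
    rw [← hm 1]
    simp
  rw [h2] at hg
  have hf1 : 0 < f 1 := by
    by_contra! h3
    nlinarith
  -- By assumption `u ≤ f g < c * f 1`, so the constant `u / f 1` belongs to `O` although the
  -- functional takes the value `u` on it.
  have h4 := hfO ((u / f 1) • 1) (fun x => by
    simp only [ContinuousMap.smul_apply, smul_eq_mul, ContinuousMap.one_apply, mul_one]
    rw [div_lt_iff₀ hf1]
    linarith)
  rw [map_smul, smul_eq_mul, div_mul_cancel₀ _ hf1.ne'] at h4
  exact lt_irrefl _ h4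

end Separation

/-! ### Continuous densities with finite support -/

section Density

variable {X V : Type*}

variable {Γ : Type*} [Group Γ] [MulAction Γ V] [MulAction Γ X]

/-- The total deviation from equivariance of a family of densities. -/
noncomputable def defect (E : Finset Γ) (ζ : X → V → ℝ) (z : X) : ℝ :=
  ∑ s ∈ E, ∑' v, |ζ z (s⁻¹ • v) - ζ (s • z) v|

theorem hasSum_comp_smul {f : V → ℝ} {a : ℝ} (h : HasSum f a) (s : Γ) :
    HasSum (fun v => f (s • v)) a :=
  (Equiv.hasSum_iff (MulAction.toPerm s)).2 h

theorem summable_defect {ζ : X → V → ℝ} (h : ∀ z, HasSum (ζ z) 1) (s : Γ) (z : X) :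
    Summable fun v => |ζ z (s⁻¹ • v) - ζ (s • z) v| :=
  ((hasSum_comp_smul (h z) s⁻¹).summable.sub (h (s • z)).summable).abs

/-- A continuous family of probability densities on `V` supported in a fixed finite set. -/
structure IsDensity [TopologicalSpace X] (F : Finset V) (ζ : X → V → ℝ) : Prop where
  cont : ∀ v, Continuous fun z => ζ z v
  nonneg : ∀ z v, 0 ≤ ζ z v
  zero : ∀ z, ∀ v ∉ F, ζ z v = 0
  sum : ∀ z, ∑ v ∈ F, ζ z v = 1

variable [TopologicalSpace X]

theorem IsDensity.mono {F F' : Finset V} {ζ : X → V → ℝ} (h : IsDensity F ζ) (hF : F ⊆ F') :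
    IsDensity F' ζ where
  cont := h.cont
  nonneg := h.nonneg
  zero z v hv := h.zero z v fun h' => hv (hF h')
  sum z := by
    rw [← h.sum z]
    exact (Finset.sum_subset hF fun v _ hv => h.zero z v hv).symm

theorem IsDensity.hasSum {F : Finset V} {ζ : X → V → ℝ} (h : IsDensity F ζ) (z : X) :
    HasSum (ζ z) 1 := by
  have h1 : HasSum (ζ z) (∑ v ∈ F, ζ z v) := hasSum_sum_of_ne_finset_zero (h.zero z)
  rwa [h.sum z] at h1

theorem IsDensity.combo {F : Finset V} {ζ ζ' : X → V → ℝ} (h : IsDensity F ζ)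
    (h' : IsDensity F ζ') {a b : ℝ} (ha : 0 ≤ a) (hb : 0 ≤ b) (hab : a + b = 1) :
    IsDensity F (fun z v => a * ζ z v + b * ζ' z v) where
  cont v := ((h.cont v).const_mul a).add ((h'.cont v).const_mul b)
  nonneg z v := add_nonneg (mul_nonneg ha (h.nonneg z v)) (mul_nonneg hb (h'.nonneg z v))
  zero z v hv := by simp [h.zero z v hv, h'.zero z v hv]
  sum z := by rw [Finset.sum_add_distrib, ← Finset.mul_sum, ← Finset.mul_sum, h.sum, h'.sum]; linarith

theorem IsDensity.continuous_defect [ContinuousConstSMul Γ X] {F : Finset V} {ζ : X → V → ℝ}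
    (h : IsDensity F ζ) (E : Finset Γ) : Continuous (defect E ζ) := by
  classical
  refine continuous_finsetSum _ fun s _ => ?_
  have : (fun z => ∑' v, |ζ z (s⁻¹ • v) - ζ (s • z) v|) =
      fun z => ∑ v ∈ F ∪ F.image (s • ·), |ζ z (s⁻¹ • v) - ζ (s • z) v| := by
    ext z
    refine tsum_eq_sum fun v hv => ?_
    simp only [Finset.mem_union, Finset.mem_image, not_or] at hv
    rw [h.zero _ v hv.1, h.zero _ _ fun h' => hv.2 ⟨_, h', smul_inv_smul s v⟩]
    simp
  rw [this]
  refine continuous_finsetSum _ fun v _ => ?_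
  exact ((h.cont _).sub ((h.cont v).comp (continuous_const_smul s))).abs

theorem IsDensity.defect_combo_le {F : Finset V} {ζ ζ' : X → V → ℝ} (h : IsDensity F ζ)
    (h' : IsDensity F ζ') (E : Finset Γ) {a b : ℝ} (ha : 0 ≤ a) (hb : 0 ≤ b) (hab : a + b = 1)
    (z : X) : defect E (fun z v => a * ζ z v + b * ζ' z v) z ≤
      a * defect E ζ z + b * defect E ζ' z := by
  unfold defect
  rw [Finset.mul_sum, Finset.mul_sum, ← Finset.sum_add_distrib]
  refine Finset.sum_le_sum fun s _ => ?_
  have h1 := summable_defect h.hasSum s z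
  have h2 := summable_defect h'.hasSum s z
  have h3 := summable_defect (h.combo h' ha hb hab).hasSum s z
  refine hasSum_le (fun v => ?_) h3.hasSum ((h1.hasSum.mul_left a).add (h2.hasSum.mul_left b))
  have e : a * ζ z (s⁻¹ • v) + b * ζ' z (s⁻¹ • v) - (a * ζ (s • z) v + b * ζ' (s • z) v) =
      a * (ζ z (s⁻¹ • v) - ζ (s • z) v) + b * (ζ' z (s⁻¹ • v) - ζ' (s • z) v) := by ring
  rw [e]
  refine (abs_add_le _ _).trans ?_
  rw [abs_mul, abs_mul, abs_of_nonneg ha, abs_of_nonneg hb]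

/-- The distance between a density supported in `F` and an arbitrary one. -/
theorem IsDensity.hasSum_abs_sub {F : Finset V} {ζ : X → V → ℝ} (h : IsDensity F ζ)
    {f : V → ℝ} (hf0 : ∀ v, 0 ≤ f v) (hf : HasSum f 1) (z : X) :
    HasSum (fun v => |ζ z v - f v|) (∑ v ∈ F, |ζ z v - f v| + (1 - ∑ v ∈ F, f v)) := by
  classical
  have h1 : HasSum (fun v => |ζ z v - f v| - f v) (∑ v ∈ F, (|ζ z v - f v| - f v)) := by
    refine hasSum_sum_of_ne_finset_zero fun v hv => ?_
    rw [h.zero z v hv, zero_sub, abs_neg, abs_of_nonneg (hf0 v), sub_self]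
  have h2 := h1.add hf
  simp only [sub_add_cancel] at h2
  convert h2 using 1
  rw [Finset.sum_sub_distrib]
  ring

/-- Normalization of finitely many nonnegative continuous functions to a density. -/
theorem exists_isDensity_close {F : Finset V} {v₀ : V} (hv₀ : v₀ ∈ F) {g : X → V → ℝ}
    (hg : ∀ v, Continuous fun z => g z v) (hg0 : ∀ z v, 0 ≤ g z v) :
    ∃ ζ : X → V → ℝ, IsDensity F ζ ∧
      ∀ z, ∑ v ∈ F, |ζ z v - g z v| ≤ |1 - ∑ v ∈ F, g z v| := by
  classical
  set S : X → ℝ := fun z => ∑ v ∈ F, g z v with hS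
  have hSc : Continuous S := continuous_finsetSum _ fun v _ => hg v
  have hm : ∀ z, 0 < max 1 (S z) := fun z => lt_max_of_lt_left one_pos
  -- Missing mass is added at `v₀` and excess mass is divided out. Either way all changes have the
  -- same sign, so they total `|1 - S z|`.
  let ζ : X → V → ℝ := fun z v =>
    if v ∈ F then (g z v + if v = v₀ then max 0 (1 - S z) else 0) / max 1 (S z) else 0
  have hsum : ∀ z, ∑ v ∈ F, ζ z v = 1 := by
    intro z
    rw [Finset.sum_congr rfl (g := fun v =>
      (g z v + if v = v₀ then max 0 (1 - S z) else 0) / max 1 (S z)) fun v hv => if_pos hv,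
      ← Finset.sum_div, Finset.sum_add_distrib, Finset.sum_ite_eq' F v₀, if_pos hv₀,
      div_eq_one_iff_eq (hm z).ne']
    show S z + _ = _
    rcases le_total 1 (S z) with h | h
    · rw [max_eq_left (by linarith), max_eq_right h, add_zero]
    · rw [max_eq_right (by linarith), max_eq_left h]
      ring
  refine ⟨ζ, ⟨fun v => ?_, fun z v => ?_, fun z v hv => if_neg hv, hsum⟩, fun z => ?_⟩
  · by_cases hv : v ∈ F
    · simp only [ζ, if_pos hv]
      refine Continuous.div₀ ((hg v).add ?_) (continuous_const.max hSc) fun z => (hm z).ne'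
      split_ifs
      · exact continuous_const.max (continuous_const.sub hSc)
      · exact continuous_const
    · simp only [ζ, if_neg hv]
      exact continuous_const
  · by_cases hv : v ∈ F
    · simp only [ζ, if_pos hv]
      refine div_nonneg (add_nonneg (hg0 z v) ?_) (hm z).le
      split_ifs
      · exact le_max_left _ _
      · exact le_rfl
    · simp only [ζ, if_neg hv]
      exact le_rfl
  · rcases le_total 1 (S z) with h | h
    · have h1 : ∀ v ∈ F, |ζ z v - g z v| = g z v - ζ z v := by
        intro v hv
        simp only [ζ, if_pos hv, max_eq_right h, max_eq_left (show 1 - S z ≤ 0 by linarith),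
          ite_self, add_zero]
        rw [abs_sub_comm, abs_of_nonneg]
        exact sub_nonneg.2 (div_le_self (hg0 z v) h)
      rw [Finset.sum_congr rfl h1, Finset.sum_sub_distrib, hsum]
      show S z - 1 ≤ |1 - S z|
      rw [abs_sub_comm]
      exact le_abs_self _
    · have h1 : ∀ v ∈ F, |ζ z v - g z v| = ζ z v - g z v := by
        intro v hv
        simp only [ζ, if_pos hv, max_eq_left h, div_one, max_eq_right (show 0 ≤ 1 - S z by linarith)]
        refine abs_of_nonneg ?_
        split_ifs <;> linarith
      rw [Finset.sum_congr rfl h1, Finset.sum_sub_distrib, hsum]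
      exact le_abs_self _

end Density

/-! ### From Borel to continuous densities -/

section Approximation

open MeasureTheory

variable {X V : Type*} [TopologicalSpace X] [CompactSpace X] [T2Space X] [MeasurableSpace X]
  [BorelSpace X] [Countable V] [Nonempty V]

/-- Measurable families of densities are `L¹`-limits of continuous ones. -/
theorem exists_isDensity_integral_le (m : Measure X) [IsFiniteMeasure m] [m.WeaklyRegular]
    {η : X → V → ℝ} (hmeas : ∀ v, Measurable fun z => η z v) (hη0 : ∀ z v, 0 ≤ η z v)
    (hη1 : ∀ z, HasSum (η z) 1) {τ : ℝ} (hτ : 0 < τ) :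
    ∃ (F : Finset V) (ζ : X → V → ℝ), IsDensity F ζ ∧
      Integrable (fun z => ∑ v ∈ F, |ζ z v - η z v| + (1 - ∑ v ∈ F, η z v)) m ∧
      ∫ z, (∑ v ∈ F, |ζ z v - η z v| + (1 - ∑ v ∈ F, η z v)) ∂m ≤ τ := by
  classical
  have hηle : ∀ z v, η z v ≤ 1 := fun z v => le_hasSum (hη1 z) v fun w _ => hη0 z w
  have hint : ∀ v, Integrable (fun z => η z v) m := fun v =>
    Integrable.of_bound (hmeas v).aestronglyMeasurable 1 (Filter.Eventually.of_forall fun z => by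
      rw [Real.norm_of_nonneg (hη0 z v)]
      exact hηle z v)
  have hsle : ∀ (F : Finset V) z, ∑ v ∈ F, η z v ≤ 1 := fun F z =>
    sum_le_hasSum F (fun v _ => hη0 z v) (hη1 z)
  have hsummable : Summable fun v => ∫ z, ‖η z v‖ ∂m := by
    refine summable_of_sum_le (c := m.real Set.univ)
      (fun v => integral_nonneg fun z => norm_nonneg _) fun F => ?_
    rw [← integral_finsetSum _ fun v _ => (hint v).norm]
    have := integral_mono (μ := m) (integrable_finsetSum F fun v _ => (hint v).norm)
      (integrable_const (1 : ℝ)) (fun z => by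
        simp only [Real.norm_of_nonneg (hη0 z _)]
        exact hsle F z)
    simpa using this
  have hsum := hasSum_integral_of_summable_integral_norm hint hsummable
  have hone : ∫ z, ∑' v, η z v ∂m = m.real Set.univ := by
    simp [fun z => (hη1 z).tsum_eq]
  rw [hone] at hsum
  -- The set `F` misses at most `τ / 4` of the integrated mass, and the continuous approximants lose
  -- at most another `τ / 4` in total; by `hbound` each error counts twice.
  obtain ⟨F₀, hF₀⟩ := (hsum.eventually (lt_mem_nhds
    (show m.real Set.univ - τ / 4 < m.real Set.univ by linarith))).exists_forall_of_atTop
  obtain ⟨v₀⟩ := ‹Nonempty V›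
  set F := insert v₀ F₀ with hF
  have hFtail := hF₀ F (Finset.subset_insert _ _)
  rw [← integral_finsetSum _ fun v _ => hint v] at hFtail
  have hcard : (0 : ℝ) < F.card := by
    exact_mod_cast Finset.card_pos.2 ⟨v₀, Finset.mem_insert_self _ _⟩
  choose g₀ hg₀ hg₀i using fun v => (hint v).exists_boundedContinuous_integral_sub_le
    (show 0 < τ / (4 * F.card) by positivity)
  set g : X → V → ℝ := fun z v => max (g₀ v z) 0 with hg
  obtain ⟨ζ, hζ, hζg⟩ := exists_isDensity_close (Finset.mem_insert_self v₀ F₀) (g := g)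
    (fun v => (g₀ v).continuous.max continuous_const) (fun z v => le_max_right _ _)
  have hmeasD : Measurable fun z => ∑ v ∈ F, |ζ z v - η z v| + (1 - ∑ v ∈ F, η z v) := by
    refine Measurable.add (Finset.measurable_sum _ fun v _ => ?_)
      (measurable_const.sub (Finset.measurable_sum _ fun v _ => hmeas v))
    have : Measurable fun z => ζ z v - η z v := (hζ.cont v).measurable.sub (hmeas v)
    exact measurable_norm.comp this
  have hbound : ∀ z, ∑ v ∈ F, |ζ z v - η z v| + (1 - ∑ v ∈ F, η z v) ≤
      2 * ∑ v ∈ F, ‖η z v - g₀ v z‖ + 2 * (1 - ∑ v ∈ F, η z v) := by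
    intro z
    have h1 : ∑ v ∈ F, |ζ z v - η z v| ≤ ∑ v ∈ F, |ζ z v - g z v| + ∑ v ∈ F, |g z v - η z v| := by
      rw [← Finset.sum_add_distrib]
      exact Finset.sum_le_sum fun v _ => abs_sub_le _ _ _
    have h2 : |1 - ∑ v ∈ F, g z v| ≤ (1 - ∑ v ∈ F, η z v) + ∑ v ∈ F, |g z v - η z v| := by
      have e : 1 - ∑ v ∈ F, g z v = (1 - ∑ v ∈ F, η z v) - ∑ v ∈ F, (g z v - η z v) := by
        rw [Finset.sum_sub_distrib]
        ring
      rw [e]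
      refine (abs_sub _ _).trans (add_le_add ?_ (Finset.abs_sum_le_sum_abs _ _))
      rw [abs_of_nonneg (sub_nonneg.2 (hsle F z))]
    have h3 : ∑ v ∈ F, |g z v - η z v| ≤ ∑ v ∈ F, ‖η z v - g₀ v z‖ := by
      refine Finset.sum_le_sum fun v _ => ?_
      rw [Real.norm_eq_abs, abs_sub_comm (η z v)]
      have : η z v = max (η z v) 0 := (max_eq_left (hη0 z v)).symm
      conv_lhs => rw [this]
      exact abs_max_sub_max_le_abs _ _ _
    have := hζg z
    linarith
  have hni : ∀ v, Integrable (fun z => ‖η z v - g₀ v z‖) m := fun v =>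
    ((hint v).sub (hg₀i v)).norm
  have hSi : Integrable (fun z => ∑ v ∈ F, η z v) m := integrable_finsetSum F fun v _ => hint v
  have hRint₁ : Integrable (fun z => 2 * ∑ v ∈ F, ‖η z v - g₀ v z‖) m :=
    (integrable_finsetSum F fun v _ => hni v).const_mul 2
  have hRint₂ : Integrable (fun z => 2 * (1 - ∑ v ∈ F, η z v)) m :=
    ((integrable_const 1).sub hSi).const_mul 2
  have hRint : Integrable (fun z => 2 * ∑ v ∈ F, ‖η z v - g₀ v z‖ +
      2 * (1 - ∑ v ∈ F, η z v)) m := hRint₁.add hRint₂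
  have hDint : Integrable (fun z => ∑ v ∈ F, |ζ z v - η z v| + (1 - ∑ v ∈ F, η z v)) m := by
    refine hRint.mono' hmeasD.aestronglyMeasurable (Filter.Eventually.of_forall fun z => ?_)
    rw [Real.norm_of_nonneg]
    · exact hbound z
    · exact add_nonneg (Finset.sum_nonneg fun _ _ => abs_nonneg _) (sub_nonneg.2 (hsle F z))
  refine ⟨F, ζ, hζ, hDint, (integral_mono hDint hRint hbound).trans ?_⟩
  rw [integral_add hRint₁ hRint₂, integral_const_mul, integral_const_mul,
    integral_sub (integrable_const 1) hSi, integral_finsetSum _ fun v _ => hni v]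
  have h1 : ∑ v ∈ F, ∫ z, ‖η z v - g₀ v z‖ ∂m ≤ τ / 4 := by
    refine (Finset.sum_le_card_nsmul F _ _ fun v _ => hg₀ v).trans ?_
    rw [nsmul_eq_mul]
    field_simp
    exact le_rfl
  have h2 : ∫ _ : X, (1 : ℝ) ∂m = m.real Set.univ := by simp
  rw [h2]
  linarith

variable {Γ : Type*} [Group Γ] [MulAction Γ V] [MulAction Γ X] [ContinuousConstSMul Γ X]

/-- A measurable almost equivariant family of densities can be replaced by a continuous one with
finite support. -/
theorem exists_isDensity_defect_lt (E : Finset Γ) {ε : ℝ} {η : X → V → ℝ}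
    (hmeas : ∀ v, Measurable fun z => η z v) (hη0 : ∀ z v, 0 ≤ η z v)
    (hη1 : ∀ z, HasSum (η z) 1)
    (hη : ∀ s ∈ E, ∀ z, ∑' v, |η z (s⁻¹ • v) - η (s • z) v| ≤ ε) {c : ℝ} (hc0 : 0 < c)
    (hc : E.card * ε < c) :
    ∃ (F : Finset V) (ζ : X → V → ℝ), IsDensity F ζ ∧ ∀ z, defect E ζ z < c := by
  classical
  -- Taking all functions that dominate some defect makes `Q` convex, since the defect is a convex
  -- function of the density.
  set Q : Set C(X, ℝ) := {g | ∃ (F : Finset V) (ζ : X → V → ℝ), IsDensity F ζ ∧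
    ∀ z, defect E ζ z ≤ g z}
  have hQ : Convex ℝ Q := by
    rintro g ⟨F, ζ, hζ, h⟩ g' ⟨F', ζ', hζ', h'⟩ a b ha hb hab
    have h1 := hζ.mono (Finset.subset_union_left (s₂ := F'))
    have h2 := hζ'.mono (Finset.subset_union_right (s₁ := F))
    refine ⟨_, _, h1.combo h2 ha hb hab, fun z => (h1.defect_combo_le h2 E ha hb hab z).trans ?_⟩
    simp only [ContinuousMap.add_apply, ContinuousMap.smul_apply, smul_eq_mul]
    exact add_le_add (mul_le_mul_of_nonneg_left (h z) ha) (mul_le_mul_of_nonneg_left (h' z) hb)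
  have hQmem : ∀ (F : Finset V) (ζ : X → V → ℝ) (hζ : IsDensity F ζ),
      (⟨defect E ζ, hζ.continuous_defect E⟩ : C(X, ℝ)) ∈ Q := fun F ζ hζ =>
    ⟨F, ζ, hζ, fun z => le_rfl⟩
  have hQne : Q.Nonempty := by
    obtain ⟨v₀⟩ := ‹Nonempty V›
    obtain ⟨ζ, hζ, -⟩ := exists_isDensity_close (X := X) (F := {v₀}) (v₀ := v₀)
      (g := fun _ _ => 0) (by simp) (fun _ => continuous_const) (fun _ _ => le_rfl)
    exact ⟨_, hQmem _ ζ hζ⟩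
  obtain ⟨g, ⟨F, ζ, hζ, h⟩, hg⟩ := exists_forall_lt_of_forall_integral_lt hQ hQne hc0 (by
    intro m hm1 hm2 hm0
    have hmpos : 0 < m.real Set.univ := by
      rw [measureReal_def]
      exact ENNReal.toReal_pos (by simpa using hm0) (measure_ne_top _ _)
    have hinner : ∀ s : Γ, (m.map (s • ·)).InnerRegular := fun s =>
      Measure.InnerRegular.map_of_continuous (continuous_const_smul s)
    -- Approximation in `L¹` of the sum of translates controls the error both at `z` and at `s • z`.
    set m' : Measure X := ∑ s ∈ insert 1 E, m.map (s • ·) with hm'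
    have hle : ∀ s ∈ insert 1 E, m.map (s • ·) ≤ m' := fun s hs =>
      Finset.single_le_sum (f := fun s => m.map (s • ·)) (fun _ _ => Measure.zero_le _) hs
    have hm1' : m ≤ m' := by
      have := hle 1 (Finset.mem_insert_self _ _)
      simpa using this
    set N : ℝ := (E.card : ℝ) with hN
    have hN0 : 0 ≤ N := by positivity
    -- This makes `N * (2 * τ + ε * m(X))`, the bound for the integrated defect, smaller than `c *
    -- m(X)`.
    set τ : ℝ := (c - N * ε) * m.real Set.univ / (2 * N + 1) / 2 with hτ
    have hτ0 : 0 < τ := by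
      have : 0 < c - N * ε := by linarith
      positivity
    obtain ⟨F, ζ, hζ, hDi, hD⟩ := exists_isDensity_integral_le m' hmeas hη0 hη1 hτ0
    set D : X → ℝ := fun z => ∑ v ∈ F, |ζ z v - η z v| + (1 - ∑ v ∈ F, η z v)
    have hDsum : ∀ z, HasSum (fun v => |ζ z v - η z v|) (D z) := fun z =>
      hζ.hasSum_abs_sub (hη0 z) (hη1 z) z
    have hD0 : ∀ z, 0 ≤ D z := fun z => (hDsum z).nonneg fun v => abs_nonneg _
    have hDm : Integrable D m := hDi.mono_measure hm1'
    have hDs : ∀ s ∈ E, Integrable (fun z => D (s • z)) m ∧ ∫ z, D (s • z) ∂m ≤ τ := by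
      intro s hs
      have h1 := hDi.mono_measure (hle s (Finset.mem_insert_of_mem hs))
      have hms : AEMeasurable (fun z : X => s • z) m :=
        (continuous_const_smul s).measurable.aemeasurable
      refine ⟨(integrable_map_measure h1.aestronglyMeasurable hms).1 h1, ?_⟩
      rw [← integral_map hms h1.aestronglyMeasurable]
      exact (integral_mono_measure (hle s (Finset.mem_insert_of_mem hs))
        (Filter.Eventually.of_forall hD0) hDi).trans hD
    have hDm' : ∫ z, D z ∂m ≤ τ :=
      (integral_mono_measure hm1' (Filter.Eventually.of_forall hD0) hDi).trans hD
    have hpt : ∀ z, defect E ζ z ≤ ∑ s ∈ E, (D z + ε + D (s • z)) := by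
      intro z
      refine Finset.sum_le_sum fun s hs => ?_
      have h1 := hasSum_comp_smul (hDsum z) s⁻¹
      have h2 := (summable_defect hη1 s z).hasSum
      have h3 := hDsum (s • z)
      have h4 := (summable_defect hζ.hasSum s z).hasSum
      refine (hasSum_le (fun v => ?_) h4 ((h1.add h2).add h3)).trans ?_
      · have e1 := abs_sub_le (ζ z (s⁻¹ • v)) (η z (s⁻¹ • v)) (ζ (s • z) v)
        have e2 := abs_sub_le (η z (s⁻¹ • v)) (η (s • z) v) (ζ (s • z) v)
        rw [abs_sub_comm (η (s • z) v)] at e2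
        linarith
      · have := hη s hs z
        linarith
    refine ⟨_, hQmem F ζ hζ, ?_⟩
    have hDε : Integrable (fun z => D z + ε) m := hDm.add (integrable_const ε)
    have hRi : ∀ s ∈ E, Integrable (fun z => D z + ε + D (s • z)) m := fun s hs =>
      hDε.add (hDs s hs).1
    have hci : Integrable (defect E ζ) m :=
      (BoundedContinuousFunction.mkOfCompact
        (⟨defect E ζ, hζ.continuous_defect E⟩ : C(X, ℝ))).integrable m
    have h5 := integral_mono hci (integrable_finsetSum E hRi) hpt
    rw [integral_finsetSum E hRi] at h5
    have h6 : ∑ s ∈ E, ∫ z, (D z + ε + D (s • z)) ∂m ≤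
        ∑ _s ∈ E, (τ + ε * m.real Set.univ + τ) := by
      refine Finset.sum_le_sum fun s hs => ?_
      rw [integral_add hDε (hDs s hs).1,
        integral_add hDm (integrable_const ε), integral_const, smul_eq_mul]
      have := (hDs s hs).2
      linarith
    rw [Finset.sum_const, nsmul_eq_mul] at h6
    show ∫ z, defect E ζ z ∂m < _
    refine (h5.trans h6).trans_lt ?_
    have h7 : τ * (2 * N + 1) * 2 = (c - N * ε) * m.real Set.univ := by
      rw [hτ]
      field_simp
    have h8 : 0 < (c - N * ε) * m.real Set.univ := mul_pos (by linarith) hmpos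
    nlinarith)
  exact ⟨F, ζ, hζ, fun z => (h z).trans_lt (hg z)⟩

end Approximation


/-! ### Induction from stabilizers and the diagonal action -/

section Product

variable {Γ : Type v} [Group Γ]

/-- Extension by zero of a function on a subgroup. -/
noncomputable def extendZero (S : Subgroup Γ) (f : S → ℝ) : Γ → ℝ :=
  Function.extend Subtype.val f 0

theorem extendZero_apply {S : Subgroup Γ} (f : S → ℝ) {t : Γ} (ht : t ∈ S) :
    extendZero S f t = f ⟨t, ht⟩ :=
  Subtype.val_injective.extend_apply f 0 ⟨t, ht⟩

theorem extendZero_of_notMem {S : Subgroup Γ} (f : S → ℝ) {t : Γ} (ht : t ∉ S) :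
    extendZero S f t = 0 :=
  Function.extend_apply' _ _ _ fun ⟨a, ha⟩ => ht (ha ▸ a.2)

theorem hasSum_extendZero {S : Subgroup Γ} {f : S → ℝ} {a : ℝ} (h : HasSum f a) :
    HasSum (extendZero S f) a := by
  refine (Function.Injective.hasSum_iff (g := (Subtype.val : S → Γ)) Subtype.val_injective
    fun t ht => ?_).1 ?_
  · exact extendZero_of_notMem f fun h' => ht ⟨⟨t, h'⟩, rfl⟩
  · convert h using 1
    ext t
    exact extendZero_apply f t.2

theorem extendZero_nonneg {S : Subgroup Γ} {f : S → ℝ} (h : ∀ t, 0 ≤ f t) (t : Γ) :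
    0 ≤ extendZero S f t := by
  by_cases ht : t ∈ S
  · rw [extendZero_apply f ht]
    exact h _
  · rw [extendZero_of_notMem f ht]

theorem hasSum_abs_sub_extendZero {S : Subgroup Γ} {f f' : S → ℝ} {a : ℝ} (h : S)
    (hs : HasSum (fun t => |f (h⁻¹ * t) - f' t|) a) :
    HasSum (fun t => |extendZero S f ((h : Γ)⁻¹ * t) - extendZero S f' t|) a := by
  convert hasSum_extendZero hs using 1
  ext t
  by_cases ht : t ∈ S
  · have ht' : (h : Γ)⁻¹ * t ∈ S := S.mul_mem (S.inv_mem h.2) ht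
    rw [extendZero_apply _ ht, extendZero_apply _ ht, extendZero_apply _ ht']
    rfl
  · have ht' : (h : Γ)⁻¹ * t ∉ S := fun h' => ht (by
      have := S.mul_mem h.2 h'
      rwa [mul_inv_cancel_left] at this)
    rw [extendZero_of_notMem _ ht, extendZero_of_notMem _ ht, extendZero_of_notMem _ ht']
    simp

theorem hasSum_mul_left_comp {f : Γ → ℝ} {a : ℝ} (h : HasSum f a) (s : Γ) :
    HasSum (fun t => f (s * t)) a :=
  (Equiv.hasSum_iff (Equiv.mulLeft s)).2 h

variable {V : Type u} [MulAction Γ V]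

theorem exists_orbit_section : ∃ (a : V → V) (σ : V → Γ), (∀ v, σ v • a v = v) ∧
    ∀ (s : Γ) v, a (s • v) = a v := by
  let a : V → V := fun v => (Quotient.mk (MulAction.orbitRel Γ V) v).out
  have ha : ∀ v, ∃ s : Γ, s • a v = v := fun v => by
    have h : (MulAction.orbitRel Γ V).r (a v) v :=
      Quotient.exact (s := MulAction.orbitRel Γ V) (Quotient.out_eq _)
    obtain ⟨s, hs⟩ := MulAction.orbitRel_apply.1 ((MulAction.orbitRel Γ V).symm h)
    exact ⟨s, hs⟩
  choose σ hσ using ha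
  refine ⟨a, σ, hσ, fun s v => ?_⟩
  have : Quotient.mk (MulAction.orbitRel Γ V) (s • v) = Quotient.mk (MulAction.orbitRel Γ V) v :=
    Quotient.sound (s := MulAction.orbitRel Γ V) (MulAction.orbitRel_apply.2 ⟨s, rfl⟩)
  simp only [a, this]

/-- Families of densities on `Γ` indexed by the vertices, from the amenability of stabilizers. -/
theorem exists_vertex_densities {Y : Type w} [TopologicalSpace Y] [MulAction Γ Y]
    [ContinuousConstSMul Γ Y]
    (hstab : ∀ x : V, IsAmenableAction (MulAction.stabilizer Γ x) Y) (E : Finset Γ) (F : Finset V)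
    {ε : ℝ} (hε : 0 < ε) : ∃ κ : V → Y → Γ → ℝ, (∀ v t, Continuous fun y => κ v y t) ∧
      (∀ v y t, 0 ≤ κ v y t) ∧ (∀ v y, HasSum (κ v y) 1) ∧
      ∀ s ∈ E, ∀ v ∈ F, ∀ y, ∑' t, |κ v y (s⁻¹ * t) - κ (s • v) (s • y) t| ≤ ε := by
  classical
  obtain ⟨a, σ, hσ, ha⟩ := exists_orbit_section (Γ := Γ) (V := V)
  -- The elements `(σ (s • v))⁻¹ * s * σ v` fix the orbit representative `a v`. Only finitely many
  -- occur for `s ∈ E` and `v ∈ F`, so amenability of the stabilizers applies to them.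
  set T : Finset Γ := (E ×ˢ F).image fun q => (σ (q.1 • q.2))⁻¹ * q.1 * σ q.2 with hT
  choose ν hν hν' using fun x => hstab x
    (Finset.subtype (fun g => g ∈ MulAction.stabilizer Γ x) T) ε hε
  have hext : ∀ x y, HasSum (extendZero _ (ν x y).1) 1 := fun x y => hasSum_extendZero (ν x y).2.2
  -- The density at `v` is the translate by `σ v` of the stabilizer's density at `(σ v)⁻¹ • y`. Its
  -- defect under `s` is exactly the stabilizer's defect under the element `h` below.
  refine ⟨fun v y t => extendZero _ (ν (a v) ((σ v)⁻¹ • y)).1 ((σ v)⁻¹ * t), fun v t => ?_,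
    fun v y t => extendZero_nonneg (ν _ _).2.1 _, fun v y => hasSum_mul_left_comp (hext _ _) _,
    fun s hs v hv y => ?_⟩
  · by_cases ht : (σ v)⁻¹ * t ∈ MulAction.stabilizer Γ (a v)
    · simp only [extendZero_apply _ ht]
      exact (continuous_apply _).comp (continuous_subtype_val.comp
        ((hν (a v)).comp (continuous_const_smul (σ v)⁻¹)))
    · simp only [extendZero_of_notMem _ ht]
      exact continuous_const
  · set h : Γ := (σ (s • v))⁻¹ * s * σ v with hh
    have hmem : h ∈ MulAction.stabilizer Γ (a v) := by
      rw [MulAction.mem_stabilizer_iff, hh, mul_smul, mul_smul, hσ, inv_smul_eq_iff]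
      conv_rhs => rw [← ha s v]
      exact (hσ _).symm
    have hhT : (⟨h, hmem⟩ : MulAction.stabilizer Γ (a v)) ∈
        Finset.subtype (fun g => g ∈ MulAction.stabilizer Γ (a v)) T := by
      rw [Finset.mem_subtype, hT, Finset.mem_image]
      exact ⟨(s, v), Finset.mk_mem_product hs hv, rfl⟩
    have h1 := hν' (a v) _ hhT ((σ v)⁻¹ • y)
    have hsm : Summable fun t => |(ν (a v) ((σ v)⁻¹ • y)).1
        ((⟨h, hmem⟩ : MulAction.stabilizer Γ (a v))⁻¹ * t) -
        (ν (a v) ((⟨h, hmem⟩ : MulAction.stabilizer Γ (a v)) • (σ v)⁻¹ • y)).1 t| :=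
      ((hasSum_mul_left_comp (ν (a v) ((σ v)⁻¹ • y)).2.2 _).summable.sub
        (ν (a v) _).2.2.summable).abs
    have h2 := hasSum_mul_left_comp (hasSum_abs_sub_extendZero _ hsm.hasSum) (σ (s • v))⁻¹
    have e1 : (⟨h, hmem⟩ : MulAction.stabilizer Γ (a v)) • (σ v)⁻¹ • y = (σ (s • v))⁻¹ • s • y := by
      show h • (σ v)⁻¹ • y = _
      rw [hh, mul_smul, smul_inv_smul, mul_smul]
    have e2 : ∀ t, h⁻¹ * ((σ (s • v))⁻¹ * t) = (σ v)⁻¹ * (s⁻¹ * t) := fun t => by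
      rw [hh]
      group
    simp only [e2] at h2
    rw [e1] at h1 h2
    let M : V → Y → Γ → ℝ := fun x y => extendZero _ (ν x y).1
    show ∑' t, |M (a v) ((σ v)⁻¹ • y) ((σ v)⁻¹ * (s⁻¹ * t)) -
      M (a (s • v)) ((σ (s • v))⁻¹ • s • y) ((σ (s • v))⁻¹ * t)| ≤ ε
    rw [ha s v]
    exact h2.tsum_eq.trans_le h1

/-- If the stabilizers of the points of `V` act amenably on `Y` and `X` carries almost equivariant
continuous families of densities on `V`, then the diagonal action on `X × Y` is amenable. -/
theorem isAmenableAction_prod {X Y : Type*} [TopologicalSpace X] [MulAction Γ X]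
    [TopologicalSpace Y] [MulAction Γ Y] [ContinuousConstSMul Γ Y]
    (hstab : ∀ x : V, IsAmenableAction (MulAction.stabilizer Γ x) Y)
    (hX : ∀ (E : Finset Γ) (ε : ℝ), 0 < ε → ∃ (F : Finset V) (ζ : X → V → ℝ),
      IsDensity F ζ ∧ ∀ z, defect E ζ z < ε) :
    IsAmenableAction Γ (X × Y) := by
  classical
  intro E ε hε
  obtain ⟨F, ζ, hζ, hdef⟩ := hX E (ε / 2) (by linarith)
  -- The finite support `F` is fixed before `κ` is chosen, since `κ` is almost equivariant only over
  -- `E` and `F`. The map sought is the mixture of the `κ v` with weights `ζ z v`.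
  obtain ⟨κ, hκc, hκ0, hκ1, hκ⟩ := exists_vertex_densities hstab E F (ε := ε / 2) (by linarith)
  have hsum : ∀ q : X × Y, HasSum (fun t => ∑ v ∈ F, ζ q.1 v * κ v q.2 t) 1 := fun q => by
    have := hasSum_sum (s := F) fun v _ => (hκ1 v q.2).mul_left (ζ q.1 v)
    simpa only [mul_one, hζ.sum] using this
  refine ⟨fun q => ⟨fun t => ∑ v ∈ F, ζ q.1 v * κ v q.2 t,
    fun t => Finset.sum_nonneg fun v _ => mul_nonneg (hζ.nonneg _ _) (hκ0 _ _ _), hsum q⟩, ?_, ?_⟩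
  · refine Continuous.subtype_mk (continuous_pi fun t => continuous_finsetSum _ fun v _ => ?_) _
    exact ((hζ.cont v).comp continuous_fst).mul ((hκc v t).comp continuous_snd)
  · rintro s hs ⟨z, y⟩
    show ∑' t, |∑ v ∈ F, ζ z v * κ v y (s⁻¹ * t) - ∑ v ∈ F, ζ (s • z) v * κ v (s • y) t| ≤ ε
    -- Reindexing the second sum by `v ↦ s • v` moves its support to `s⁻¹ • F`; `W` contains both
    -- supports.
    set W : Finset V := F ∪ F.image (s⁻¹ • ·) with hW
    have e1 : ∀ t, ∑ v ∈ F, ζ z v * κ v y (s⁻¹ * t) = ∑ v ∈ W, ζ z v * κ v y (s⁻¹ * t) := fun t =>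
      Finset.sum_subset Finset.subset_union_left fun v _ hv => by rw [hζ.zero z v hv, zero_mul]
    have e2 : ∀ t, ∑ v ∈ F, ζ (s • z) v * κ v (s • y) t =
        ∑ v ∈ W, ζ (s • z) (s • v) * κ (s • v) (s • y) t := fun t => by
      rw [← Finset.sum_subset (Finset.subset_union_right (s₁ := F) (s₂ := F.image (s⁻¹ • ·)))
        (fun v _ hv => by
          rw [hζ.zero _ (s • v) fun h => hv (Finset.mem_image.2 ⟨_, h, inv_smul_smul s v⟩),
            zero_mul]), Finset.sum_image fun v _ v' _ h => MulAction.injective s⁻¹ h]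
      simp only [smul_inv_smul]
    have hk : ∀ v, HasSum (fun t => |κ v y (s⁻¹ * t) - κ (s • v) (s • y) t|)
        (∑' t, |κ v y (s⁻¹ * t) - κ (s • v) (s • y) t|) := fun v =>
      ((hasSum_mul_left_comp (hκ1 v y) s⁻¹).summable.sub (hκ1 _ _).summable).abs.hasSum
    have hb := (hasSum_sum (s := W) fun v _ => (hk v).mul_left (ζ z v)).add
      (hasSum_sum (s := W) fun v _ =>
        (hκ1 (s • v) (s • y)).mul_left |ζ z v - ζ (s • z) (s • v)|)
    have hle : ∀ t, |∑ v ∈ F, ζ z v * κ v y (s⁻¹ * t) - ∑ v ∈ F, ζ (s • z) v * κ v (s • y) t| ≤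
        ∑ v ∈ W, ζ z v * |κ v y (s⁻¹ * t) - κ (s • v) (s • y) t| +
          ∑ v ∈ W, |ζ z v - ζ (s • z) (s • v)| * κ (s • v) (s • y) t := by
      intro t
      rw [e1, e2, ← Finset.sum_sub_distrib, ← Finset.sum_add_distrib]
      refine (Finset.abs_sum_le_sum_abs _ _).trans (Finset.sum_le_sum fun v _ => ?_)
      have e : ζ z v * κ v y (s⁻¹ * t) - ζ (s • z) (s • v) * κ (s • v) (s • y) t =
          ζ z v * (κ v y (s⁻¹ * t) - κ (s • v) (s • y) t) +
            (ζ z v - ζ (s • z) (s • v)) * κ (s • v) (s • y) t := by ring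
      rw [e]
      refine (abs_add_le _ _).trans ?_
      rw [abs_mul, abs_mul, abs_of_nonneg (hζ.nonneg z v), abs_of_nonneg (hκ0 _ _ _)]
    have hsm := ((hasSum_mul_left_comp (hsum (z, y)) s⁻¹).summable.sub
      (hsum (s • z, s • y)).summable).abs
    refine (hasSum_le hle hsm.hasSum hb).trans ?_
    have h1 : ∑ v ∈ W, ζ z v * ∑' t, |κ v y (s⁻¹ * t) - κ (s • v) (s • y) t| ≤ ε / 2 := by
      rw [← Finset.sum_subset (Finset.subset_union_left (s₁ := F)) fun v _ hv => by
        rw [hζ.zero z v hv, zero_mul]]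
      calc _ ≤ ∑ v ∈ F, ζ z v * (ε / 2) := Finset.sum_le_sum fun v hv =>
            mul_le_mul_of_nonneg_left (hκ s hs v hv y) (hζ.nonneg z v)
        _ = ε / 2 := by rw [← Finset.sum_mul, hζ.sum, one_mul]
    have h2 : ∑ v ∈ W, |ζ z v - ζ (s • z) (s • v)| * 1 ≤ ε / 2 := by
      simp only [mul_one]
      have h3 := hasSum_comp_smul (summable_defect hζ.hasSum s z).hasSum s
      simp only [inv_smul_smul] at h3
      refine (sum_le_hasSum W (fun v _ => abs_nonneg _) h3).trans ?_
      refine le_trans ?_ (hdef z).le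
      exact Finset.single_le_sum (f := fun s => ∑' v, |ζ z (s⁻¹ • v) - ζ (s • z) v|)
        (fun s _ => tsum_nonneg fun v => abs_nonneg _) hs
    linarith

end Product

end FineHyp

theorem theorem1 {V : Type u} {Γ : Type v} {Y : Type w}
    [Countable V] (K : SimpleGraph V)
    (hconn : K.Connected) (hfine : FineHyp.IsFine K) (hhyp : FineHyp.IsHyperbolic K)
    [Group Γ] [MulAction Γ V] [FineHyp.ActsOnGraph Γ K]
    (hquot : FineHyp.HasFiniteQuotient Γ K)
    [TopologicalSpace Y] [CompactSpace Y] [T2Space Y]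
    [MulAction Γ Y] [ContinuousConstSMul Γ Y]
    (hstab : ∀ x : V, FineHyp.IsAmenableAction (MulAction.stabilizer Γ x) Y) :
    CompactSpace (FineHyp.Delta K) ∧ T2Space (FineHyp.Delta K) ∧
      ContinuousConstSMul Γ (FineHyp.Delta K) ∧
      FineHyp.IsAmenableAction Γ (FineHyp.Delta K × Y) := by
  obtain ⟨δ, H⟩ := hhyp.exists_unifFineHyp hconn hfine hquot
  have := H.compactSpace
  have := H.t2Space
  have := hconn.nonempty
  refine ⟨‹_›, ‹_›, inferInstance, FineHyp.isAmenableAction_prod hstab fun E ε hε => ?_⟩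
  borelize (FineHyp.Delta K)
  -- The defect is a sum over `E`, and `E.card * (ε / (E.card + 1)) < ε`.
  obtain ⟨η, h1, h2, h3, h4⟩ := H.exists_measurable_almost_equivariant E
    (show 0 < ε / (E.card + 1) by positivity)
  refine FineHyp.exists_isDensity_defect_lt E h1 h2 h3 h4 hε ?_
  rw [mul_div_assoc', div_lt_iff₀ (by positivity)]
  linarith
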